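/- Let $K$ be an algebraically closed field of characteristic $0$, let $T=(K^\times)^r$ be a torus with Lie algebra $\mathfrak t=K^r$, and let $T$ act on $V=K^n$ with weights $s_1,\dots,s_n\in\mathbb Z^r$, that is, $t\cdot v=\big(\prod_j t_j^{s_i^j}\,v_i\big)_i$; every finite-dimensional rational representation of a torus is of this form in suitable coordinates. Let $T$ act on $V^*$ by the contragredient action and diagonally on $V\oplus V^*$, and let $\mu:V\oplus V^*\to\mathfrak t^*$, $\mu(x,\varphi)(h)=\varphi(h\cdot x)$, be the moment map. "Closed" refers to the Zariski topology. An element $x\in V$ is nilpotent if $0\in\overline{T.x}$, and $(T,V)$ is visible if it has finitely many nilpotent $T$-orbits. (1) The representation $(T,V)$ is visible if and only if the closed $T$-orbits in $\mu^{-1}(0)$ are exactly the orbits $T.(x,y)$ with $(x,y)\in\mu^{-1}(0)$ and with both $T.x\subset V$ and $T.y\subset V^*$ closed. (2) The visibility hypothesis is necessary in the following conjecture (Conjecture A, stated for $K=\mathbb C$ and all connected reductive groups): if $(G,V)$ is visible and polar, then $\mu^{-1}(0)/\!/G\cong(\mathfrak c\oplus\mathfrak c^\vee)/W$ as Poisson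 varieties, where $\mathfrak c$ is a Cartan subspace of $V$, $\mathfrak c^\vee$ is a dual Cartan subspace of $V^*$ (isomorphic to $\mathfrak c^*$ as a $W$-module) and $W=N_G(\mathfrak c)/C_G(\mathfrak c)$. Precisely, call $\mathfrak c\subset V$ a Cartan subspace if $\mathfrak c=\{x\in V\mid\mathfrak t\cdot x\subseteq\mathfrak t\cdot v\}$ for some $v\in V$ and $\dim\mathfrak c=\dim V/\!/T$; $(T,V)$ is polar if a Cartan subspace exists. Assume that $(T,V)$ is polar and not visible, let $\mathfrak c$ be any Cartan subspace of $V$ and let $W=N_T(\mathfrak c)/C_T(\mathfrak c)$. Then: (a) for every linear subspace $\mathfrak c'\subset V^*$ (in particular for $\mathfrak c'=\mathfrak c^\vee$), there is a closed $T$-orbit in $\mu^{-1}(0)$ that is not contained in the closure of the $T$-orbit of any point of $\mathfrak c\times\mathfrak c'$; in particular, the natural map $(\mathfrak c\oplus\mathfrak c^\vee)/W\to\mu^{-1}(0)/\!/T$ is not surjective; (b) the $K$-algebras $K[\mu^{-1}(0)]^T$ and $K[\mathfrak c\oplus\mathfrak c^*]^W$ are not isomorphic, where $\mu^{-1}(0)$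 is the scheme-theoretic fibre; so $\mu^{-1}(0)/\!/T$ and $(\mathfrak c\oplus\mathfrak c^*)/W$ are not isomorphic as varieties, hence not as Poisson varieties. -/

import Mathlib

noncomputable section

namespace MomentTorus

/-! ### Polynomial functions and the Zariski topology of a vector space -/

section Zariski

variable (K : Type*) [Field K] (W : Type*) [AddCommGroup W] [Module K W]

/-- The algebra `K[W]` of polynomial functions on a `K`-vector space `W`: the algebra of
functions generated by the linear forms. -/
def polyFun : Subalgebra K (W → K) :=
  Algebra.adjoin K (Set.range fun l : Module.Dual K W => (l : W → K))

variable {K W} {W' : Type*} [AddCommGroup W'] [Module K W']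

theorem polyFun_comp_mem (g : W' →ₗ[K] W) {f : W → K} (hf : f ∈ polyFun K W) :
    f ∘ g ∈ polyFun K W' := by
  unfold polyFun at hf
  induction hf using Algebra.adjoin_induction with
  | mem f hf =>
    obtain ⟨l, rfl⟩ := hf
    exact Algebra.subset_adjoin ⟨l.comp g, rfl⟩
  | algebraMap a => exact (polyFun K W').algebraMap_mem a
  | add f₁ f₂ _ _ h₁ h₂ => exact (polyFun K W').add_mem h₁ h₂
  | mul f₁ f₂ _ _ h₁ h₂ => exact (polyFun K W').mul_mem h₁ h₂

/-- Pull-back of polynomial functions along a linear map. -/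
def polyFunComap (g : W' →ₗ[K] W) : polyFun K W →ₐ[K] polyFun K W' where
  toFun f := ⟨f.1 ∘ g, polyFun_comp_mem g f.2⟩
  map_one' := rfl
  map_mul' _ _ := rfl
  map_zero' := rfl
  map_add' _ _ := rfl
  commutes' _ := rfl

variable (K) in
/-- `Z` is the common zero locus of a set of polynomial functions. -/
def IsZariskiClosed (Z : Set W) : Prop :=
  ∃ F : Set (polyFun K W), Z = {w | ∀ f ∈ F, f.1 w = 0}

variable (K) in
/-- The Zariski closure of `Z`. -/
def zariskiClosure (Z : Set W) : Set W :=
  {w | ∀ f : polyFun K W, (∀ z ∈ Z, f.1 z = 0) → f.1 w = 0}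

end Zariski

/-! ### Orbits, semisimple and nilpotent elements, visible representations, invariants -/

section Rep

variable {K : Type*} [Field K] {G : Type*} [Group G] {V : Type*} [AddCommGroup V] [Module K V]

/-- The orbit `G.x`. -/
def repOrbit (ρ : Representation K G V) (x : V) : Set V :=
  Set.range fun g : G => ρ g x

/-- `x` is semisimple: its orbit is closed. -/
def IsSemisimpleElt (ρ : Representation K G V) (x : V) : Prop :=
  IsZariskiClosed K (repOrbit ρ x)

/-- `x` is nilpotent: the closure of its orbit contains `0`. -/
def IsNilpotentElt (ρ : Representation K G V) (x : V) : Prop :=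
  (0 : V) ∈ zariskiClosure K (repOrbit ρ x)

/-- The representation is visible: there are finitely many nilpotent orbits. -/
def IsVisible (ρ : Representation K G V) : Prop :=
  {O : Set V | ∃ x, IsNilpotentElt ρ x ∧ O = repOrbit ρ x}.Finite

/-- The algebra `K[V]^G` of invariant polynomial functions, that is, the coordinate ring of the
categorical quotient `V // G`. -/
def invariantFun (ρ : Representation K G V) : Subalgebra K (polyFun K V) where
  carrier := {f | ∀ g : G, polyFunComap (ρ g) f = f}
  mul_mem' ha hb g := by rw [map_mul, ha g, hb g]
  add_mem' ha hb g := by rw [map_add, ha g, hb g]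
  algebraMap_mem' a g := AlgHom.commutes _ a

/-- The representation of `G` on `V ⊕ V*`, with the contragredient action on `V*`. -/
def doubleRep (ρ : Representation K G V) : Representation K G (V × Module.Dual K V) :=
  ρ.prod ρ.dual

end Rep

/-! ### Moment map, symplectic reduction, Cartan subspaces

Here `𝔤` is the Lie algebra of `G` (only its underlying vector space is needed), acting on `V`
through the differential `dρ` of the representation `ρ`. -/

section Moment

variable {K : Type*} [Field K] {G : Type*} [Group G] {V : Type*} [AddCommGroup V] [Module K V]
  {𝔤 : Type*} [AddCommGroup 𝔤] [Module K 𝔤]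

/-- The moment map `V ⊕ V* → 𝔤*`, `(x, φ) ↦ (h ↦ φ (h · x))`. -/
def momentMap (dρ : 𝔤 →ₗ[K] Module.End K V) (z : V × Module.Dual K V) : Module.Dual K 𝔤 :=
  z.2 ∘ₗ dρ.flip z.1

/-- The points of the null fibre of the moment map. -/
def nullFibre (dρ : 𝔤 →ₗ[K] Module.End K V) : Set (V × Module.Dual K V) :=
  {z | momentMap dρ z = 0}

/-- The ideal of the scheme `μ⁻¹(0)`: it is generated by the components of the moment map, that
is, by the functions `z ↦ μ(z)(h)` for `h` in the Lie algebra. -/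
def momentIdeal (dρ : 𝔤 →ₗ[K] Module.End K V) : Ideal (polyFun K (V × Module.Dual K V)) :=
  Ideal.span {f | ∃ h : 𝔤, ∀ z, f.1 z = momentMap dρ z h}

/-- Polynomial functions on `V ⊕ V*` whose class modulo the ideal of `μ⁻¹(0)` is invariant. -/
def invariantModMoment (ρ : Representation K G V) (dρ : 𝔤 →ₗ[K] Module.End K V) :
    Subalgebra K (polyFun K (V × Module.Dual K V)) where
  carrier := {f | ∀ g : G, polyFunComap (doubleRep ρ g) f - f ∈ momentIdeal dρ}
  mul_mem' := by
    intro a b ha hb g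
    have h := (momentIdeal dρ).add_mem
      ((momentIdeal dρ).mul_mem_left (polyFunComap (doubleRep ρ g) a) (hb g))
      ((momentIdeal dρ).mul_mem_left b (ha g))
    rw [map_mul]
    convert h using 1
    ring
  add_mem' := by
    intro a b ha hb g
    have h := (momentIdeal dρ).add_mem (ha g) (hb g)
    rw [map_add]
    convert h using 1
    ring
  algebraMap_mem' := by
    intro a g
    rw [AlgHom.commutes, sub_self]
    exact (momentIdeal dρ).zero_mem

/-- The algebra `K[μ⁻¹(0)]^G`, that is, the coordinate ring of the symplectic reduction
`(V ⊕ V*) /// G = μ⁻¹(0) // G`. -/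
def symplecticReductionRing (ρ : Representation K G V) (dρ : 𝔤 →ₗ[K] Module.End K V) :
    Subalgebra K (polyFun K (V × Module.Dual K V) ⧸ momentIdeal dρ) :=
  (invariantModMoment ρ dρ).map (Ideal.Quotient.mkₐ K (momentIdeal dρ))

/-- The tangent space `𝔤 · x`. -/
def tangentSpace (dρ : 𝔤 →ₗ[K] Module.End K V) (x : V) : Submodule K V :=
  LinearMap.range (dρ.flip x)

/-- The subspace `{x | 𝔤 · x ⊆ 𝔤 · v}`. -/
def cartanOf (dρ : 𝔤 →ₗ[K] Module.End K V) (v : V) : Submodule K V where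
  carrier := {x | tangentSpace dρ x ≤ tangentSpace dρ v}
  zero_mem' := by
    rintro _ ⟨h, rfl⟩
    simp
  add_mem' := by
    rintro a b ha hb _ ⟨h, rfl⟩
    rw [map_add, LinearMap.add_apply]
    exact add_mem (ha ⟨h, rfl⟩) (hb ⟨h, rfl⟩)
  smul_mem' := by
    rintro k a ha _ ⟨h, rfl⟩
    rw [map_smul, LinearMap.smul_apply]
    exact Submodule.smul_mem _ k (ha ⟨h, rfl⟩)

/-- `c` is a Cartan subspace of `V`: `c = {x | 𝔤 · x ⊆ 𝔤 · v}` for some `v`, and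
`dim c = dim V // G`. The dimension of the irreducible variety `V // G` is the transcendence
degree of its coordinate ring. -/
def IsCartanSubspace (ρ : Representation K G V) (dρ : 𝔤 →ₗ[K] Module.End K V)
    (c : Submodule K V) : Prop :=
  ∃ v : V, c = cartanOf dρ v ∧ (Module.finrank K c : Cardinal) = Algebra.trdeg K (invariantFun ρ)

/-- The Weyl group `N_G(c) / C_G(c)` of a subspace `c`, as the group of the automorphisms of `c`
that are induced by an element of `G`. -/
def weylGroup (ρ : Representation K G V) (c : Submodule K V) : Subgroup (c ≃ₗ[K] c) where
  carrier := {w | ∃ g : G, ∀ x : c, ρ g x = w x}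
  one_mem' := ⟨1, fun x => by simp⟩
  mul_mem' := by
    rintro a b ⟨g, hg⟩ ⟨h, hh⟩
    exact ⟨g * h, fun x => by simp [hh, hg]⟩
  inv_mem' := by
    rintro a ⟨g, hg⟩
    refine ⟨g⁻¹, fun x => ?_⟩
    have h := hg (a⁻¹ x)
    rw [show a (a⁻¹ x) = x from a.apply_symm_apply x] at h
    rw [← h, ← Module.End.mul_apply, ← map_mul]
    simp

/-- The diagonal action of an automorphism `w` of `c` on `c ⊕ c*`:
`(x, φ) ↦ (w x, φ ∘ w⁻¹)`. -/
def doubleAut {c : Submodule K V} (w : c ≃ₗ[K] c) :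
    (c × Module.Dual K c) →ₗ[K] (c × Module.Dual K c) :=
  w.toLinearMap.prodMap (w.symm.toLinearMap.dualMap)

/-- The algebra `K[c ⊕ c*]^W`, that is, the coordinate ring of `(c ⊕ c*) / W`, for `W` the Weyl
group of `c`. -/
def weylInvariantRing (ρ : Representation K G V) (c : Submodule K V) :
    Subalgebra K (polyFun K (c × Module.Dual K c)) where
  carrier := {f | ∀ w ∈ weylGroup ρ c, polyFunComap (doubleAut w) f = f}
  mul_mem' ha hb w hw := by rw [map_mul, ha w hw, hb w hw]
  add_mem' ha hb w hw := by rw [map_add, ha w hw, hb w hw]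
  algebraMap_mem' a w _ := AlgHom.commutes _ a

end Moment

/-! ### Representations of tori -/

section Torus

variable (K : Type*) [Field K] {r n : ℕ}

/-- The representation of the torus `(Kˣ)^r` on `K^n` with weights `s 0, …, s (n - 1)`:
`t` multiplies the coordinate `i` by `∏ j, t j ^ s i j`. -/
def torusRep (s : Fin n → Fin r → ℤ) : Representation K (Fin r → Kˣ) (Fin n → K) where
  toFun t := LinearMap.pi fun i =>
    ((∏ j, t j ^ s i j : Kˣ) : K) • (LinearMap.proj i : (Fin n → K) →ₗ[K] K)
  map_one' := by
    ext
    simp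
  map_mul' t u := by
    refine LinearMap.ext fun v => funext fun i => ?_
    simp [mul_zpow, Finset.prod_mul_distrib, mul_assoc]

/-- The differential of `torusRep K s`: `h` in the Lie algebra `K^r` multiplies the coordinate `i`
by `∑ j, s i j * h j`. -/
def torusLie (s : Fin n → Fin r → ℤ) : (Fin r → K) →ₗ[K] Module.End K (Fin n → K) :=
  LinearMap.mk₂ K (fun h v i => (∑ j, (s i j : K) * h j) * v i)
    (fun h h' v => by
      funext i
      simp [mul_add, Finset.sum_add_distrib, add_mul])
    (fun a h v => by
      funext i
      simp only [Pi.smul_apply, smul_eq_mul]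
      rw [← mul_assoc, Finset.mul_sum]
      congr 1
      exact Finset.sum_congr rfl fun j _ => by ring)
    (fun h v v' => by
      funext i
      simp [mul_add])
    (fun a h v => by
      funext i
      simp only [Pi.smul_apply, smul_eq_mul]
      ring)

end Torus

end MomentTorus

end

/-! Everything reduces to the linear relations `∑ c_i s_i = 0` among the weights. Since the group of
units of `K` is divisible, points with the same support lie in one orbit as soon as they agree on
the Laurent monomials of all relations on that support (`exists_torusChar_eq`,
`IsDiagonal.mem_orbit`). With Tucker's strict complementarity, an orbit is closed iff its support is
the support of a nonnegative relation (`IsDiagonal.isSemisimpleElt_iff`). Visibility means that the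
support of each nonzero relation contains that of a nonzero nonnegative relation
(`PositivelyDependent`, `IsDiagonal.isVisible_iff`). Finally, `(x, y)` is in the null fibre iff the
vector `(x_i y_i)` is a relation over `K`.

(1) Under positive dependence every nonzero coordinate of a component of a closed orbit in the null
fibre is covered by a nonnegative relation inside the support of that component; adding these up
shows that both components have closed orbits. Conversely, a relation that violates positive
dependence is the product vector of a point whose two components share its support. The double orbit
of this point is always closed, but its first component does not have a closed orbit.

(2) Write the Cartan subspace as `cartanOf v`, let `m` be the dimension of the space of relations
and let `ω` be a generic relation supported on `v`. Multiplication by `x / v`, for `x` in the Cartan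
subspace, preserves the relations supported on `v`, so `x ↦ ω x / v` maps the Cartan subspace to
relations. If this map is onto, then for each relation `c` and a nonnegative relation `a` of maximal
support, `c² / a` is again a relation; it is nonnegative with the support of `c`, so the
representation is visible (`positivelyDependent_of_surjective`). Hence without visibility the image
has dimension less than `m`.

This deficit gives both conclusions. For (a), either some relation leaves the support of `v`, which
is an obstruction by supports alone, or the `m` independent Laurent monomials of relations take
arbitrary nonzero values on closed orbits of the null fibre, whereas on the Cartan subspace they
depend on fewer than `m` parameters. For (b), the symplectic reduction has transcendence degree at
least `2 m`, while the Weyl group invariants have transcendence degree at most the dimension of the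
image plus `dim c`, which is less than `m + m`. -/

noncomputable section

namespace MomentTorus

/-! ### Linear relations among integer vectors -/

section Relations

/-- The lemma of Farkas over a linearly ordered field. -/
theorem farkas {F V ι : Type*} [Field F] [LinearOrder F] [IsStrictOrderedRing F]
    [AddCommGroup V] [Module F V] (I : Finset ι) :
    ∀ (a : ι → Module.Dual F V) (b : Module.Dual F V),
      (∀ x, (∀ i ∈ I, 0 ≤ a i x) → 0 ≤ b x) →
      ∃ c : ι → F, (∀ i, 0 ≤ c i) ∧ b = ∑ i ∈ I, c i • a i := by
  classical
  induction I using Finset.induction_on with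
  | empty =>
    intro a b h
    refine ⟨0, fun _ => le_rfl, ?_⟩
    ext x
    have h1 := h x (by simp)
    have h2 := h (-x) (by simp)
    rw [map_neg] at h2
    simp only [Finset.sum_empty, LinearMap.zero_apply]
    linarith
  | insert k I hk ih =>
    intro a b h
    by_cases hb : ∀ x, (∀ i ∈ I, 0 ≤ a i x) → 0 ≤ b x
    · obtain ⟨c, hc, hbc⟩ := ih a b hb
      refine ⟨Function.update c k 0, fun i => ?_, ?_⟩
      · by_cases hik : i = k
        · subst hik; simp
        · simp [hik, hc i]
      · rw [Finset.sum_insert hk, hbc]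
        simp only [Function.update_self, zero_smul, zero_add]
        refine Finset.sum_congr rfl fun i hi => ?_
        rw [Function.update_of_ne (ne_of_mem_of_not_mem hi hk)]
    · push Not at hb
      obtain ⟨y, hy, hby⟩ := hb
      have hky : a k y < 0 := by
        by_contra hcon
        refine absurd (h y ?_) (not_le.2 hby)
        intro i hi
        rcases Finset.mem_insert.1 hi with rfl | hi
        · exact not_lt.1 hcon
        · exact hy i hi
      obtain ⟨z, hz, hkz, hbz⟩ : ∃ z, (∀ i ∈ I, 0 ≤ a i z) ∧ a k z = -1 ∧ b z < 0 := by
        refine ⟨(-(a k y))⁻¹ • y, fun i hi => ?_, ?_, ?_⟩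
        · rw [map_smul, smul_eq_mul]
          exact mul_nonneg (inv_nonneg.2 (by linarith)) (hy i hi)
        · rw [map_smul, smul_eq_mul, inv_neg, neg_mul, inv_mul_cancel₀ hky.ne]
        · rw [map_smul, smul_eq_mul]
          exact mul_neg_of_pos_of_neg (inv_pos.2 (by linarith)) hby
      -- The map `x ↦ x + a k x • z` projects onto the kernel of `a k`, because `a k z = -1`. The
      -- induction hypothesis is applied to the pull-backs of the forms along it.
      obtain ⟨c, hc, hbc⟩ := ih (fun i => a i + a i z • a k) (b + b z • a k) (by
        intro x hx
        have := h (x + a k x • z) (by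
          intro i hi
          rcases Finset.mem_insert.1 hi with rfl | hi
          · simp [hkz]
          · have := hx i hi
            simp only [LinearMap.add_apply, LinearMap.smul_apply, smul_eq_mul, map_add,
              map_smul] at this ⊢
            linarith [mul_comm (a i z) (a k x)])
        simp only [LinearMap.add_apply, LinearMap.smul_apply, smul_eq_mul, map_add,
          map_smul] at this ⊢
        linarith [mul_comm (b z) (a k x)])
      refine ⟨Function.update c k (∑ i ∈ I, c i * a i z - b z), fun i => ?_, ?_⟩
      · by_cases hik : i = k
        · subst hik
          rw [Function.update_self]
          have := Finset.sum_nonneg fun i hi => mul_nonneg (hc i) (hz i hi)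
          linarith
        · simp [hik, hc i]
      · rw [Finset.sum_insert hk, Function.update_self]
        have : ∑ i ∈ I, Function.update c k (∑ i ∈ I, c i * a i z - b z) i • a i =
            ∑ i ∈ I, c i • a i := by
          refine Finset.sum_congr rfl fun i hi => ?_
          rw [Function.update_of_ne (ne_of_mem_of_not_mem hi hk)]
        have hb : b = ∑ i ∈ I, c i • (a i + a i z • a k) - b z • a k := eq_sub_of_add_eq hbc
        rw [this]
        ext x
        have hbx := congrArg (fun f : Module.Dual F V => f x) hb
        simp only [LinearMap.sub_apply, LinearMap.add_apply, LinearMap.smul_apply,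
          LinearMap.sum_apply, smul_eq_mul, mul_add, Finset.sum_add_distrib, ← mul_assoc,
          ← Finset.sum_mul] at hbx ⊢
        linear_combination hbx

theorem exists_int_multiple {ι : Type*} [Fintype ι] (f : ι → ℚ) :
    ∃ (N : ℤ) (g : ι → ℤ), 0 < N ∧ ∀ i, (g i : ℚ) = N * f i := by
  classical
  refine ⟨∏ i, ((f i).den : ℤ), fun i => (∏ j ∈ Finset.univ.erase i, ((f j).den : ℤ)) * (f i).num,
    Finset.prod_pos fun i _ => by exact_mod_cast (f i).den_pos, fun i => ?_⟩
  rw [← Finset.mul_prod_erase Finset.univ (fun i => ((f i).den : ℤ)) (Finset.mem_univ i)]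
  push_cast
  rw [mul_comm ((f i).den : ℚ), mul_assoc, mul_comm ((f i).den : ℚ), Rat.mul_den_eq_num]

/-! ### Integral relations, complementarity and positive dependence -/

variable {ι : Type*} [Fintype ι] {r : ℕ}

/-- `c` is a linear relation among the vectors `w i`. -/
def IsRel (w : ι → Fin r → ℤ) (c : ι → ℤ) : Prop :=
  ∀ j, ∑ i, c i * w i j = 0

variable {w : ι → Fin r → ℤ} {c d : ι → ℤ}

theorem isRel_zero : IsRel w 0 := fun j => by simp

theorem IsRel.add (hc : IsRel w c) (hd : IsRel w d) : IsRel w (c + d) := fun j => by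
  simp [add_mul, Finset.sum_add_distrib, hc j, hd j]

theorem IsRel.smul (hc : IsRel w c) (k : ℤ) : IsRel w (k • c) := fun j => by
  simp [mul_assoc, ← Finset.mul_sum, hc j]

theorem IsRel.neg (hc : IsRel w c) : IsRel w (-c) := fun j => by
  simp [hc j]

theorem IsRel.sum {κ : Type*} (I : Finset κ) {c : κ → ι → ℤ} (h : ∀ k ∈ I, IsRel w (c k)) :
    IsRel w (∑ k ∈ I, c k) := by
  classical
  induction I using Finset.induction_on with
  | empty => simpa using isRel_zero
  | insert k I hk ih =>
    rw [Finset.sum_insert hk]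
    exact (h k (by simp)).add (ih fun i hi => h i (by simp [hi]))

theorem IsRel.sum_dotProduct (hc : IsRel w c) (l : Fin r → ℤ) : ∑ i, c i * (l ⬝ᵥ w i) = 0 := by
  simp only [dotProduct, Finset.mul_sum]
  rw [Finset.sum_comm]
  refine Finset.sum_eq_zero fun j _ => ?_
  have := congrArg (l j * ·) (hc j)
  simp only [Finset.mul_sum, mul_zero] at this
  rw [← this]
  exact Finset.sum_congr rfl fun i _ => by ring

/-- Each vector of a finite family takes part in a nonnegative relation, or is strictly positive
on a vector that is nonnegative on the family. -/
theorem exists_rel_or_dotProduct_pos (w : ι → Fin r → ℤ) (I : Finset ι) {k : ι} (hk : k ∈ I) :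
    (∃ a, IsRel w a ∧ (∀ i, 0 ≤ a i) ∧ (∀ i ∉ I, a i = 0) ∧ 0 < a k) ∨
      ∃ l : Fin r → ℤ, (∀ i ∈ I, 0 ≤ l ⬝ᵥ w i) ∧ 0 < l ⬝ᵥ w k := by
  classical
  let A : ι → Module.Dual ℚ (Fin r → ℚ) := fun i =>
    ∑ j, (w i j : ℚ) • LinearMap.proj j
  have hA : ∀ i x, A i x = ∑ j, (w i j : ℚ) * x j := fun i x => by simp [A]
  by_cases h : ∀ x, (∀ i ∈ I, 0 ≤ A i x) → 0 ≤ (-A k) x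
  · left
    obtain ⟨c, hc, hbc⟩ := farkas I A (-A k) h
    -- From `-w k = ∑ c i • w i` the relation is `c` plus the unit vector at `k`, cleared of
    -- denominators. Its coefficient at `k` is positive even if `c k = 0`.
    obtain ⟨N, g, hN, hg⟩ := exists_int_multiple fun i => (if i ∈ I then c i else 0) +
      if i = k then 1 else 0
    have hN' : (0 : ℚ) < N := by exact_mod_cast hN
    have hnn : ∀ i, 0 ≤ (if i ∈ I then c i else 0) + if i = k then (1 : ℚ) else 0 := fun i =>
      add_nonneg (by split_ifs <;> simp [hc i]) (by split_ifs <;> simp)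
    refine ⟨g, fun j => ?_, fun i => ?_, fun i hi => ?_, ?_⟩
    · have h1 := congrArg (fun f : Module.Dual ℚ (Fin r → ℚ) => f (Pi.single j 1)) hbc
      simp only [LinearMap.neg_apply, LinearMap.sum_apply, LinearMap.smul_apply, hA,
        smul_eq_mul, Pi.single_apply, mul_ite, mul_one, mul_zero, Finset.sum_ite_eq',
        Finset.mem_univ, if_true] at h1
      have : ((∑ i, g i * w i j : ℤ) : ℚ) = 0 := by
        push_cast
        simp only [hg, mul_assoc, ← Finset.mul_sum, add_mul, Finset.sum_add_distrib, ite_mul,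
          zero_mul, one_mul, Finset.sum_ite_mem, Finset.univ_inter, Finset.sum_ite_eq',
          Finset.mem_univ, if_true]
        rw [← h1]
        ring
      exact_mod_cast this
    · have : (0 : ℚ) ≤ g i := by rw [hg]; exact mul_nonneg hN'.le (hnn i)
      exact_mod_cast this
    · have : (g i : ℚ) = 0 := by
        rw [hg, if_neg hi, if_neg (by rintro rfl; exact hi hk)]
        simp
      exact_mod_cast this
    · have : (0 : ℚ) < g k := by
        rw [hg, if_pos hk, if_pos rfl]
        exact mul_pos hN' (by linarith [hc k])
      exact_mod_cast this
  · right
    push Not at h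
    obtain ⟨x, hx, hkx⟩ := h
    obtain ⟨N, g, hN, hg⟩ := exists_int_multiple x
    have hN' : (0 : ℚ) < N := by exact_mod_cast hN
    have key : ∀ i, ((g ⬝ᵥ w i : ℤ) : ℚ) = N * A i x := fun i => by
      rw [hA, dotProduct, Finset.mul_sum]
      push_cast
      exact Finset.sum_congr rfl fun j _ => by rw [hg]; ring
    refine ⟨g, fun i hi => ?_, ?_⟩
    · have : (0 : ℚ) ≤ ((g ⬝ᵥ w i : ℤ) : ℚ) := by
        rw [key]; exact mul_nonneg hN'.le (hx i hi)
      exact_mod_cast this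
    · have : (0 : ℚ) < ((g ⬝ᵥ w k : ℤ) : ℚ) := by
        rw [key]; exact mul_pos hN' (by simpa using hkx)
      exact_mod_cast this

/-- Strict complementarity (Tucker): a nonnegative relation and a linear form that is nonnegative
on the family such that each vector is in the support of exactly one of them. -/
theorem exists_rel_dotProduct_complementary (w : ι → Fin r → ℤ) (I : Finset ι) :
    ∃ (a : ι → ℤ) (l : Fin r → ℤ), IsRel w a ∧ (∀ i, 0 ≤ a i) ∧ (∀ i ∉ I, a i = 0) ∧
      (∀ i ∈ I, a i = 0 → 0 < l ⬝ᵥ w i) ∧ ∀ i ∈ I, a i ≠ 0 → l ⬝ᵥ w i = 0 := by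
  classical
  -- Each alternative is completed by the zero relation or the zero form, so that the sums over all
  -- `k` serve every index at once.
  have H : ∀ k : I, ∃ (a : ι → ℤ) (l : Fin r → ℤ), IsRel w a ∧ (∀ i, 0 ≤ a i) ∧
      (∀ i ∉ I, a i = 0) ∧ (∀ i ∈ I, 0 ≤ l ⬝ᵥ w i) ∧ 0 < a k + l ⬝ᵥ w k := by
    rintro ⟨k, hk⟩
    rcases exists_rel_or_dotProduct_pos w I hk with ⟨a, h1, h2, h3, h4⟩ | ⟨l, h1, h2⟩
    · exact ⟨a, 0, h1, h2, h3, by simp, by simpa using h4⟩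
    · exact ⟨0, l, isRel_zero, by simp, by simp, h1, by simpa using h2⟩
  choose a l h1 h2 h3 h4 h5 using H
  have hrel := IsRel.sum (w := w) Finset.univ (c := a) fun k _ => h1 k
  have ha : ∀ i, 0 ≤ (∑ k, a k) i := fun i => by
    rw [Finset.sum_apply]; exact Finset.sum_nonneg fun k _ => h2 k i
  have haI : ∀ i ∉ I, (∑ k, a k) i = 0 := fun i hi => by
    rw [Finset.sum_apply]; exact Finset.sum_eq_zero fun k _ => h3 k i hi
  have hl : ∀ i ∈ I, 0 ≤ (∑ k, l k) ⬝ᵥ w i := fun i hi => by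
    rw [_root_.sum_dotProduct]; exact Finset.sum_nonneg fun k _ => h4 k i hi
  have hpos : ∀ i ∈ I, 0 < (∑ k, a k) i + (∑ k, l k) ⬝ᵥ w i := fun i hi => by
    rw [_root_.sum_dotProduct, Finset.sum_apply, ← Finset.sum_add_distrib]
    exact Finset.sum_pos' (fun k _ => add_nonneg (h2 k i) (h4 k i hi))
      ⟨⟨i, hi⟩, Finset.mem_univ _, h5 ⟨i, hi⟩⟩
  refine ⟨∑ k, a k, ∑ k, l k, hrel, ha, haI, fun i hi h0 => ?_, fun i hi h0 => ?_⟩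
  · have := hpos i hi
    rwa [h0, zero_add] at this
  -- Pairing the relation with the form gives a sum of nonnegative terms equal to `0`, so every
  -- product vanishes.
  · have h6 := hrel.sum_dotProduct (∑ k, l k)
    rw [Finset.sum_eq_zero_iff_of_nonneg] at h6
    · exact (mul_eq_zero.1 (h6 i (Finset.mem_univ i))).resolve_left h0
    · intro k _
      by_cases hk : k ∈ I
      · exact mul_nonneg (ha k) (hl k hk)
      · rw [haI k hk, zero_mul]

/-- Every nontrivial relation contains the support of a nontrivial nonnegative relation. -/
def PositivelyDependent (w : ι → Fin r → ℤ) : Prop :=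
  ∀ c, IsRel w c → c ≠ 0 → ∃ e, IsRel w e ∧ e ≠ 0 ∧ (∀ i, 0 ≤ e i) ∧ ∀ i, c i = 0 → e i = 0

/-- The ratio test of linear programming, with denominators cleared: `e k • f - f k • e` vanishes at
`k` and stays nonnegative on `p`. -/
theorem exists_min_ratio {p : ι → Prop} (f e : ι → ℤ) (hp : ∃ i, p i) (he : ∀ i, p i → 0 < e i) :
    ∃ k, p k ∧ ∀ i, p i → f k * e i ≤ f i * e k := by
  classical
  obtain ⟨i₀, hi₀⟩ := hp
  obtain ⟨k, hk, hmin⟩ := Finset.exists_min_image (Finset.univ.filter p)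
    (fun i => (f i : ℚ) / e i) ⟨i₀, by simpa using hi₀⟩
  have hk : p k := by simpa using hk
  refine ⟨k, hk, fun i hi => ?_⟩
  have h := hmin i (by simpa using hi)
  have h1 : (0 : ℚ) < e i := by exact_mod_cast he i hi
  have h2 : (0 : ℚ) < e k := by exact_mod_cast he k hk
  rw [div_le_div_iff₀ h2 h1] at h
  exact_mod_cast h

/-- Under positive dependence, the positive part of a relation is covered by nonnegative
relations. -/
theorem PositivelyDependent.exists_nonneg (hw : PositivelyDependent w) (k : ℕ) :
    ∀ c, IsRel w c → (Finset.univ.filter fun i => c i ≠ 0).card ≤ k → ∀ i, 0 < c i →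
      ∃ d, IsRel w d ∧ (∀ j, 0 ≤ d j) ∧ (∀ j, c j ≤ 0 → d j = 0) ∧ 0 < d i := by
  classical
  induction k with
  | zero =>
    intro c _ hcard i hi
    rw [Nat.le_zero, Finset.card_eq_zero, Finset.filter_eq_empty_iff] at hcard
    exact absurd (hcard (Finset.mem_univ i)) (by simpa using hi.ne')
  | succ k ih =>
    intro c hc hcard i hi
    obtain ⟨e, he, he0, hepos, hce⟩ := hw c hc fun h => by simp [h] at hi
    have drop : ∀ (c' : ι → ℤ) (m : ι), c m ≠ 0 → c' m = 0 → (∀ j, c j = 0 → c' j = 0) →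
        (Finset.univ.filter fun i => c' i ≠ 0).card ≤ k := by
      intro c' m hm hm' h
      refine Nat.le_of_lt_succ (lt_of_lt_of_le (Finset.card_lt_card ?_) hcard)
      rw [Finset.ssubset_iff_of_subset]
      · exact ⟨m, by simpa using hm, by simpa using hm'⟩
      · intro j
        simp only [Finset.mem_filter, Finset.mem_univ, true_and]
        exact fun hj hj' => hj (h j hj')
    by_cases hN : ∃ j, c j < 0 ∧ 0 < e j
    · obtain ⟨m, ⟨hm, hem⟩, hmin⟩ := exists_min_ratio (fun j => -c j) e hN fun j hj => hj.2
      have hneg : ∀ j, c j ≤ 0 → e m * c j + -c m * e j ≤ 0 := by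
        intro j hj
        rcases (hepos j).eq_or_lt with h0 | h0
        · rw [← h0]; nlinarith
        · rcases hj.eq_or_lt with h | h
          · rw [h, hce j h]; simp
          · nlinarith [hmin j ⟨h, h0⟩]
      obtain ⟨d, hd, hd0, hdc, hdi⟩ := ih (e m • c + (-c m) • e) ((hc.smul _).add (he.smul _))
        (drop _ m hm.ne (by simp; ring) fun j hj => by simp [hj, hce j hj]) i (by
          have := mul_pos hem hi
          have := mul_nonneg (neg_nonneg.2 hm.le) (hepos i)
          simp only [Pi.add_apply, Pi.smul_apply, smul_eq_mul]
          linarith)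
      exact ⟨d, hd, hd0, fun j hj => hdc j (by simpa using hneg j hj), hdi⟩
    · push Not at hN
      have hsupp : ∀ j, 0 < e j → 0 < c j := by
        intro j hj
        by_contra hcj
        rcases (not_lt.1 hcj).eq_or_lt with h | h
        · exact hj.ne' (hce j h)
        · exact absurd (hN j h) (not_le.2 hj)
      -- Now `e` lives on the positive part of `c`. If it misses `i`, a multiple of it is subtracted
      -- to kill another entry without touching `i`; otherwise `e` itself is the relation sought.
      rcases (hepos i).eq_or_lt with hi0 | hi0
      · obtain ⟨j₀, hj₀⟩ := Function.ne_iff.1 he0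
        obtain ⟨m, hem, hmin⟩ := exists_min_ratio c e
          ⟨j₀, (hepos j₀).lt_of_ne' hj₀⟩ (fun j hj => hj)
        obtain ⟨d, hd, hd0, hdc, hdi⟩ := ih (e m • c + (-c m) • e) ((hc.smul _).add (he.smul _))
          (drop _ m (hsupp m hem).ne' (by simp; ring) fun j hj => by simp [hj, hce j hj]) i (by
            simp only [Pi.add_apply, Pi.smul_apply, smul_eq_mul, ← hi0]
            nlinarith)
        refine ⟨d, hd, hd0, fun j hj => hdc j ?_, hdi⟩
        have hej : e j = 0 := by
          by_contra h
          exact absurd (hsupp j (lt_of_le_of_ne (hepos j) (Ne.symm h))) (not_lt.2 hj)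
        simp only [Pi.add_apply, Pi.smul_apply, smul_eq_mul, hej]
        nlinarith
      · refine ⟨e, he, hepos, fun j hj => ?_, hi0⟩
        by_contra h
        exact absurd (hsupp j (lt_of_le_of_ne (hepos j) (Ne.symm h))) (not_lt.2 hj)

theorem PositivelyDependent.exists_nonneg_of_pos (hw : PositivelyDependent w) (hc : IsRel w c)
    {i : ι} (hi : 0 < c i) :
    ∃ d, IsRel w d ∧ (∀ j, 0 ≤ d j) ∧ (∀ j, c j ≤ 0 → d j = 0) ∧ 0 < d i := by
  classical exact hw.exists_nonneg _ c hc le_rfl i hi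

theorem PositivelyDependent.exists_nonneg_of_ne_zero (hw : PositivelyDependent w)
    (hc : IsRel w c) {i : ι} (hi : c i ≠ 0) :
    ∃ d, IsRel w d ∧ (∀ j, 0 ≤ d j) ∧ (∀ j, c j = 0 → d j = 0) ∧ 0 < d i := by
  rcases lt_or_gt_of_ne hi with h | h
  · obtain ⟨d, h1, h2, h3, h4⟩ := hw.exists_nonneg_of_pos hc.neg (i := i) (by simpa using h)
    exact ⟨d, h1, h2, fun j hj => h3 j (by simp [hj]), h4⟩
  · obtain ⟨d, h1, h2, h3, h4⟩ := hw.exists_nonneg_of_pos hc h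
    exact ⟨d, h1, h2, fun j hj => h3 j hj.le, h4⟩

/-- Nonnegative relations that cover a set add up to one with that support. -/
theorem exists_rel_support_eq (p : ι → Prop)
    (h : ∀ i, p i → ∃ d, IsRel w d ∧ (∀ j, 0 ≤ d j) ∧ (∀ j, ¬ p j → d j = 0) ∧ 0 < d i) :
    ∃ d, IsRel w d ∧ (∀ j, 0 ≤ d j) ∧ ∀ j, d j ≠ 0 ↔ p j := by
  classical
  choose! d h1 h2 h3 h4 using h
  refine ⟨∑ i ∈ Finset.univ.filter p, d i, IsRel.sum _ fun i hi => h1 i (by simpa using hi),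
    fun j => ?_, fun j => ⟨fun hj => ?_, fun hj => ?_⟩⟩
  · rw [Finset.sum_apply]
    exact Finset.sum_nonneg fun i hi => h2 i (by simpa using hi) j
  · by_contra hpj
    refine hj ?_
    rw [Finset.sum_apply]
    exact Finset.sum_eq_zero fun i hi => h3 i (by simpa using hi) j hpj
  · rw [Finset.sum_apply]
    exact (Finset.sum_pos' (fun i hi => h2 i (by simpa using hi) j)
      ⟨j, by simpa using hj, h4 j hj⟩).ne'

/-! ### Relations with coefficients in a field -/

variable (K : Type*) [Field K]

/-- The space of `K`-linear relations among the vectors `w i`. -/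
def relSpace (w : ι → Fin r → ℤ) : Submodule K (ι → K) where
  carrier := {u | ∀ j, ∑ i, u i * (w i j : K) = 0}
  zero_mem' j := by simp
  add_mem' ha hb j := by simp [add_mul, Finset.sum_add_distrib, ha j, hb j]
  smul_mem' k a ha j := by simp [mul_assoc, ← Finset.mul_sum, ha j]

variable {K}

theorem intCast_mem_relSpace (hc : IsRel w c) : (fun i => (c i : K)) ∈ relSpace K w := fun j => by
  have := congrArg (Int.cast : ℤ → K) (hc j)
  push_cast at this
  exact this

theorem intCast_mem_relSpace_iff [CharZero K] :
    (fun i => (c i : K)) ∈ relSpace K w ↔ IsRel w c := by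
  refine ⟨fun h j => ?_, intCast_mem_relSpace⟩
  have h1 : ∑ i, (c i : K) * (w i j : K) = 0 := h j
  exact_mod_cast h1

/-- A relation over `K` is a combination of integral ones with smaller supports. -/
theorem mem_span_intCast [CharZero K] {u : ι → K} (hu : u ∈ relSpace K w) :
    u ∈ Submodule.span K {v : ι → K | ∃ c : ι → ℤ, IsRel w c ∧ (∀ i, u i = 0 → c i = 0) ∧
      v = fun i => (c i : K)} := by
  classical
  -- The weights are integral, so each coordinate of `u` with respect to a `ℚ`-basis of `K` is a
  -- rational relation, and it vanishes wherever `u` does.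
  let b := Module.Basis.ofVectorSpace ℚ K
  let B := Finset.univ.biUnion fun i => (b.repr (u i)).support
  have hsum : u = ∑ β ∈ B, b β • fun i => ((b.repr (u i) β : ℚ) : K) := by
    funext i
    rw [Finset.sum_apply]
    conv_lhs => rw [← b.linearCombination_repr (u i)]
    rw [Finsupp.linearCombination_apply, Finsupp.sum_of_support_subset (s := B)]
    · refine Finset.sum_congr rfl fun β _ => ?_
      rw [Pi.smul_apply, smul_eq_mul, Algebra.smul_def, mul_comm]
      rfl
    · exact Finset.subset_biUnion_of_mem (fun i => (b.repr (u i)).support) (Finset.mem_univ i)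
    · simp
  rw [hsum]
  refine Submodule.sum_mem _ fun β _ => Submodule.smul_mem _ _ ?_
  rw [← hsum]
  obtain ⟨N, g, hN, hg⟩ := exists_int_multiple fun i => b.repr (u i) β
  have hN' : (N : K) ≠ 0 := by exact_mod_cast hN.ne'
  have hgK : ∀ i, (g i : K) = N * ((b.repr (u i) β : ℚ) : K) := fun i => by
    have := congrArg (Rat.cast : ℚ → K) (hg i)
    push_cast at this
    exact this
  have : (fun i => ((b.repr (u i) β : ℚ) : K)) = (N : K)⁻¹ • fun i => (g i : K) := by
    funext i
    rw [Pi.smul_apply, smul_eq_mul, hgK, inv_mul_cancel_left₀ hN']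
  rw [this]
  refine Submodule.smul_mem _ _ (Submodule.subset_span ⟨g, fun j => ?_, fun i hi => ?_, rfl⟩)
  · have h1 : ∑ i, b.repr (u i) β * (w i j : ℚ) = 0 := by
      have h2 := congrArg (fun x => b.repr x β) (hu j)
      simp only [map_sum, Finsupp.coe_finsetSum, Finset.sum_apply, map_zero,
        Finsupp.coe_zero, Pi.zero_apply] at h2
      rw [← h2]
      refine Finset.sum_congr rfl fun i _ => ?_
      have : u i * (w i j : K) = (w i j : ℚ) • u i := by
        rw [Algebra.smul_def, mul_comm]; simp
      rw [this, map_smul, Finsupp.smul_apply, smul_eq_mul, mul_comm]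
    have h3 : ((∑ i, g i * w i j : ℤ) : ℚ) = 0 := by
      push_cast
      simp only [hg, mul_assoc, ← Finset.mul_sum]
      rw [h1, mul_zero]
    exact_mod_cast h3
  · have : (g i : ℚ) = 0 := by rw [hg, hi]; simp
    exact_mod_cast this

/-- Otherwise the integral relations that span `u` would all lie in the kernel of the coordinate
`i`. -/
theorem exists_int_rel_of_ne_zero [CharZero K] {u : ι → K} (hu : u ∈ relSpace K w) {i : ι}
    (hi : u i ≠ 0) : ∃ c, IsRel w c ∧ (∀ j, u j = 0 → c j = 0) ∧ c i ≠ 0 := by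
  by_contra! hcon
  refine hi ?_
  have h := mem_span_intCast hu
  have : Submodule.span K {v : ι → K | ∃ c : ι → ℤ, IsRel w c ∧ (∀ i, u i = 0 → c i = 0) ∧
      v = fun i => (c i : K)} ≤ LinearMap.ker (LinearMap.proj i : (ι → K) →ₗ[K] K) := by
    rw [Submodule.span_le]
    rintro _ ⟨c, h1, h2, rfl⟩
    simp [hcon c h1 h2]
  simpa using this h

end Relations

/-! ### Characters of a torus -/

section Characters

variable {K : Type*} [Field K] {r : ℕ} {ι : Type*} [Fintype ι] {w : ι → Fin r → ℤ}

theorem prod_zpow_eq_zpow_sum {G κ : Type*} [CommGroup G] (x : G) (I : Finset κ) (f : κ → ℤ) :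
    ∏ i ∈ I, x ^ f i = x ^ ∑ i ∈ I, f i := by
  classical
  induction I using Finset.induction_on with
  | empty => simp
  | insert k I hk ih => rw [Finset.prod_insert hk, Finset.sum_insert hk, zpow_add, ih]

/-- The value at `t` of the character with exponents `v`. -/
def torusChar (t : Fin r → Kˣ) (v : Fin r → ℤ) : Kˣ := ∏ j, t j ^ v j

theorem torusChar_neg (t : Fin r → Kˣ) (v : Fin r → ℤ) : torusChar t (-v) = (torusChar t v)⁻¹ := by
  simp [torusChar, Finset.prod_inv_distrib]

theorem torusChar_inv (t : Fin r → Kˣ) (v : Fin r → ℤ) : torusChar t⁻¹ v = (torusChar t v)⁻¹ := by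
  simp [torusChar, Finset.prod_inv_distrib]

theorem torusChar_cochar (τ : Kˣ) (l v : Fin r → ℤ) :
    torusChar (fun j => τ ^ l j) v = τ ^ (l ⬝ᵥ v) := by
  simp only [torusChar, dotProduct, ← zpow_mul]
  exact prod_zpow_eq_zpow_sum _ _ _

theorem IsRel.prod_torusChar {c : ι → ℤ} (hc : IsRel w c) (t : Fin r → Kˣ) :
    ∏ i, torusChar t (w i) ^ c i = 1 := by
  simp only [torusChar, ← Finset.prod_zpow, ← zpow_mul]
  rw [Finset.prod_comm]
  refine Finset.prod_eq_one fun j _ => ?_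
  rw [prod_zpow_eq_zpow_sum]
  simp only [mul_comm (w _ j), hc j, zpow_zero]

variable [IsAlgClosed K]

theorem units_zpow_surjective {k : ℤ} (hk : k ≠ 0) : Function.Surjective fun x : Kˣ => x ^ k := by
  intro y
  have key : ∀ y : Kˣ, ∃ x : Kˣ, x ^ k.natAbs = y := fun y => by
    obtain ⟨z, hz⟩ := IsAlgClosed.exists_pow_nat_eq (y : K) (Int.natAbs_pos.2 hk)
    have hz0 : z ≠ 0 := by
      rintro rfl
      rw [zero_pow (Int.natAbs_pos.2 hk).ne'] at hz
      exact y.ne_zero hz.symm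
    exact ⟨Units.mk0 z hz0, Units.ext hz⟩
  rcases Int.natAbs_eq k with h | h
  · obtain ⟨x, hx⟩ := key y
    exact ⟨x, by simp only; rw [h, zpow_natCast, hx]⟩
  · obtain ⟨x, hx⟩ := key y⁻¹
    exact ⟨x, by simp only; rw [h, zpow_neg, zpow_natCast, hx, inv_inv]⟩

/-- A family of units that satisfies all multiplicative relations of a family of characters is the
family of values of these characters at a point of the torus. -/
theorem exists_torusChar_eq (w : ι → Fin r → ℤ) (τ : ι → Kˣ) (p : ι → Prop)
    (h : ∀ c, IsRel w c → (∀ i, ¬ p i → c i = 0) → ∏ i, τ i ^ c i = 1) :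
    ∃ t, ∀ i, p i → torusChar t (w i) = τ i := by
  classical
  let P : Submodule ℤ (ι → ℤ) := Submodule.pi {i | ¬ p i} fun _ => ⊥
  have hP : ∀ c, c ∈ P ↔ ∀ i, ¬ p i → c i = 0 := fun c => by simp [P, Submodule.mem_pi]
  let L : P →ₗ[ℤ] (Fin r → ℤ) := Fintype.linearCombination ℤ w ∘ₗ P.subtype
  let χ : P →ₗ[ℤ] Additive Kˣ :=
    Fintype.linearCombination ℤ (fun i => Additive.ofMul (τ i)) ∘ₗ P.subtype
  have hL : ∀ c, L c = 0 → IsRel w c := fun c hc j => by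
    have := congrFun hc j
    simpa [L, Fintype.linearCombination_apply, Finset.sum_apply] using this
  have hχ : ∀ c : P, χ c = Additive.ofMul (∏ i, τ i ^ c.1 i) := fun c => by
    simp [χ, Fintype.linearCombination_apply]
  have hker : LinearMap.ker L ≤ LinearMap.ker χ := fun c hc => by
    rw [LinearMap.mem_ker, hχ, h c (hL c hc) ((hP c).1 c.2)]
    rfl
  -- A torus element is a homomorphism from `ℤ^r` to the units. The hypothesis lets `χ` descend to
  -- the image of `L`; divisibility makes the units an injective group, so the descended map extends
  -- to `ℤ^r`.
  let _ : DivisibleBy (Additive Kˣ) ℤ := AddCommGroup.divisibleByIntOfSMulTopEqTop _ (by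
    intro k hk
    rw [eq_top_iff]
    intro x _
    obtain ⟨y, hy⟩ := units_zpow_surjective hk x.toMul
    exact ⟨Additive.ofMul y, trivial, hy⟩)
  obtain ⟨g, hg⟩ := (Module.Baer.of_divisible (Additive Kˣ)).extension_property
    (LinearMap.range L).subtype (Submodule.injective_subtype _)
    ((LinearMap.ker L).liftQ χ hker ∘ₗ L.quotKerEquivRange.symm.toLinearMap)
  have hgL : ∀ c, g (L c) = χ c := fun c => by
    have := LinearMap.congr_fun hg ⟨L c, ⟨c, rfl⟩⟩
    simp only [LinearMap.comp_apply, Submodule.subtype_apply, LinearEquiv.coe_coe] at this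
    rw [this]
    have h2 : L.quotKerEquivRange.symm ⟨L c, ⟨c, rfl⟩⟩ = Submodule.Quotient.mk c := by
      rw [LinearEquiv.symm_apply_eq]
      rfl
    rw [h2, Submodule.liftQ_apply]
  refine ⟨fun j => (g (Pi.single j 1)).toMul, fun i hi => ?_⟩
  have hmem : Pi.single i (1 : ℤ) ∈ P := (hP _).2 fun k hk => by
    rw [Pi.single_eq_of_ne (by rintro rfl; exact hk hi)]
  have h1 := hgL ⟨_, hmem⟩
  have h2 : L ⟨_, hmem⟩ = ∑ j, w i j • Pi.single j (1 : ℤ) := by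
    simp only [L, LinearMap.comp_apply, Submodule.subtype_apply]
    rw [Fintype.linearCombination_apply_single, one_smul]
    funext j
    simp [Finset.sum_apply, Pi.single_apply]
  have h3 : χ ⟨_, hmem⟩ = Additive.ofMul (τ i) := by
    simp only [χ, LinearMap.comp_apply, Submodule.subtype_apply]
    rw [Fintype.linearCombination_apply_single, one_smul]
  rw [h2, h3, map_sum] at h1
  simp only [map_smul] at h1
  have h4 := congrArg Additive.toMul h1
  simpa [torusChar] using h4

end Characters

/-! ### Polynomial functions -/

section PolyFun

open Polynomial

universe u

variable {K : Type u} [Field K] {W W₀ : Type u} [AddCommGroup W] [Module K W]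
  [AddCommGroup W₀] [Module K W₀]

theorem linear_mem_polyFun (l : Module.Dual K W) : (l : W → K) ∈ polyFun K W :=
  Algebra.subset_adjoin ⟨l, rfl⟩

theorem const_mem_polyFun (a : K) : (fun _ => a : W → K) ∈ polyFun K W :=
  (polyFun K W).algebraMap_mem a

/-- A map is polynomial if it pulls back linear forms to polynomial functions. -/
def IsPolyMap (K : Type u) [Field K] {W W₀ : Type u} [AddCommGroup W] [Module K W]
    [AddCommGroup W₀] [Module K W₀] (g : W₀ → W) : Prop :=
  ∀ l : Module.Dual K W, (fun w => l (g w)) ∈ polyFun K W₀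

theorem IsPolyMap.comp_mem {g : W₀ → W} (hg : IsPolyMap K g) {f : W → K} (hf : f ∈ polyFun K W) :
    f ∘ g ∈ polyFun K W₀ := by
  unfold polyFun at hf
  induction hf using Algebra.adjoin_induction with
  | mem f hf =>
    obtain ⟨l, rfl⟩ := hf
    exact hg l
  | algebraMap a => exact (polyFun K W₀).algebraMap_mem a
  | add f₁ f₂ _ _ h₁ h₂ => exact (polyFun K W₀).add_mem h₁ h₂
  | mul f₁ f₂ _ _ h₁ h₂ => exact (polyFun K W₀).mul_mem h₁ h₂

/-- Pull-back along a polynomial map. -/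
def IsPolyMap.comap {g : W₀ → W} (hg : IsPolyMap K g) : polyFun K W →ₐ[K] polyFun K W₀ where
  toFun f := ⟨f.1 ∘ g, hg.comp_mem f.2⟩
  map_one' := rfl
  map_mul' _ _ := rfl
  map_zero' := rfl
  map_add' _ _ := rfl
  commutes' _ := rfl

/-- Evaluation of polynomial functions at a point. -/
def evalAt (z : W) : polyFun K W →ₐ[K] K :=
  (Pi.evalAlgHom K (fun _ : W => K) z).comp (polyFun K W).val

@[simp]
theorem evalAt_apply (z : W) (f : polyFun K W) : evalAt z f = f.1 z := rfl

/-- A polynomial function restricts to a polynomial on a polynomial curve. -/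
theorem exists_polynomial_of_curve {γ : K → W}
    (hγ : ∀ l : Module.Dual K W, ∃ p : K[X], ∀ τ, l (γ τ) = p.eval τ) {f : W → K}
    (hf : f ∈ polyFun K W) : ∃ p : K[X], ∀ τ, f (γ τ) = p.eval τ := by
  unfold polyFun at hf
  induction hf using Algebra.adjoin_induction with
  | mem f hf =>
    obtain ⟨l, rfl⟩ := hf
    exact hγ l
  | algebraMap a => exact ⟨C a, fun τ => by simp⟩
  | add f₁ f₂ _ _ h₁ h₂ =>
    obtain ⟨p, hp⟩ := h₁
    obtain ⟨q, hq⟩ := h₂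
    exact ⟨p + q, fun τ => by simp [hp, hq]⟩
  | mul f₁ f₂ _ _ h₁ h₂ =>
    obtain ⟨p, hp⟩ := h₁
    obtain ⟨q, hq⟩ := h₂
    exact ⟨p * q, fun τ => by simp [hp, hq]⟩

/-- A polynomial function that vanishes at all but finitely many points of a line vanishes on
it. -/
theorem eq_zero_of_line [Infinite K] {f : W → K} (hf : f ∈ polyFun K W) (x y : W)
    (h : {τ : K | f (x + τ • y) ≠ 0}.Finite) : f x = 0 := by
  obtain ⟨p, hp⟩ := exists_polynomial_of_curve (γ := fun τ : K => x + τ • y)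
    (fun l => ⟨C (l x) + X * C (l y), fun τ => by simp [mul_comm τ]⟩) hf
  have hp0 : p = 0 := by
    refine Polynomial.eq_zero_of_infinite_isRoot p (Set.Infinite.mono ?_ h.infinite_compl)
    intro τ hτ
    simpa [hp] using hτ
  have := hp 0
  simpa [hp0] using this

theorem trdeg_polyFun_le [FiniteDimensional K W] :
    Algebra.trdeg K (polyFun K W) ≤ Module.finrank K W := by
  let b := Module.finBasis K W
  let φ : MvPolynomial (Fin (Module.finrank K W)) K →ₐ[K] (W → K) :=
    MvPolynomial.aeval fun i w => b.coord i w
  have hle : polyFun K W ≤ φ.range := by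
    refine Algebra.adjoin_le ?_
    rintro _ ⟨l, rfl⟩
    refine ⟨∑ i, MvPolynomial.C (l (b i)) * MvPolynomial.X i, ?_⟩
    funext w
    change φ _ w = _
    simp only [φ, map_sum, map_mul, MvPolynomial.aeval_C, MvPolynomial.aeval_X, Finset.sum_apply,
      Pi.mul_apply]
    conv_rhs => rw [← b.sum_repr w, map_sum]
    refine Finset.sum_congr rfl fun i _ => ?_
    rw [map_smul, smul_eq_mul, mul_comm]
    rfl
  calc Algebra.trdeg K (polyFun K W) ≤ Algebra.trdeg K φ.range :=
        trdeg_le_of_injective (Subalgebra.inclusion hle) (Subalgebra.inclusion_injective hle)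
    _ ≤ Algebra.trdeg K (MvPolynomial (Fin (Module.finrank K W)) K) :=
        trdeg_le_of_surjective φ.rangeRestrict φ.rangeRestrict_surjective
    _ = Module.finrank K W := by simp [MvPolynomial.trdeg_of_isDomain]

/-- If functions in `A` are determined by their restriction to the slice `g`, then `A` embeds in the
polynomial functions on `W₀`. -/
theorem trdeg_le_of_slice [FiniteDimensional K W₀] (A : Subalgebra K (polyFun K W)) {g : W₀ → W}
    (hg : IsPolyMap K g) (h : ∀ f ∈ A, (∀ w, f.1 (g w) = 0) → f = 0) :
    Algebra.trdeg K A ≤ Module.finrank K W₀ := by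
  refine (trdeg_le_of_injective (hg.comap.comp A.val) ?_).trans trdeg_polyFun_le
  rw [injective_iff_map_eq_zero]
  intro f hf
  have := h f.1 f.2 fun w => congrFun (congrArg Subtype.val hf) w
  exact Subtype.ext this

/-- A polynomial `p` that kills `f` vanishes at every attained point, hence wherever `P` does not.
So `p * P` vanishes identically, and `p = 0` because `K` is infinite. -/
theorem algebraicIndependent_of_eval {ι : Type*} [Infinite K] {A : Type*} [CommRing A]
    [Algebra K A] (f : ι → A) {P : MvPolynomial ι K} (hP : P ≠ 0)
    (h : ∀ a, MvPolynomial.eval a P ≠ 0 → ∃ ε : A →ₐ[K] K, ∀ i, ε (f i) = a i) :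
    AlgebraicIndependent K f := by
  rw [algebraicIndependent_iff]
  intro p hp
  have : p * P = 0 := by
    refine MvPolynomial.funext fun a => ?_
    rw [map_mul, map_zero]
    by_cases ha : MvPolynomial.eval a P = 0
    · rw [ha, mul_zero]
    · obtain ⟨ε, hε⟩ := h a ha
      have h1 := congrArg ε hp
      have h2 : ε (MvPolynomial.aeval f p) = MvPolynomial.aeval (fun i => ε (f i)) p := by
        rw [← AlgHom.comp_apply, MvPolynomial.comp_aeval]
      rw [h2, map_zero, funext hε] at h1
      rw [← MvPolynomial.aeval_eq_eval, h1, zero_mul]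
  exact (mul_eq_zero.1 this).resolve_right hP

/-- A polynomial map whose image contains a nonempty basic open set cannot raise dimension. -/
theorem card_le_of_dominant {ι : Type*} [Fintype ι] [Infinite K] [FiniteDimensional K W]
    (f : ι → polyFun K W) {P : MvPolynomial ι K} (hP : P ≠ 0)
    (h : ∀ a, MvPolynomial.eval a P ≠ 0 → ∃ z, ∀ i, (f i).1 z = a i) :
    Fintype.card ι ≤ Module.finrank K W := by
  have h1 := (algebraicIndependent_of_eval f hP fun a ha => by
    obtain ⟨z, hz⟩ := h a ha
    exact ⟨evalAt z, hz⟩).lift_cardinalMk_le_trdeg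
  have h2 := h1.trans (Cardinal.lift_le.2 trdeg_polyFun_le)
  rw [Cardinal.mk_fintype, Cardinal.lift_natCast, Cardinal.lift_natCast] at h2
  exact_mod_cast h2

end PolyFun

/-! ### Diagonal representations of a torus -/

section Diagonal

open Polynomial

universe u

variable {K : Type u} [Field K] {r : ℕ} {ι : Type*} {w : ι → Fin r → ℤ}

variable {W : Type u} [AddCommGroup W] [Module K W]

/-- In the coordinates `e`, the torus acts diagonally with weights `w`. -/
def IsDiagonal (ρ : Representation K (Fin r → Kˣ) W) (e : W ≃ₗ[K] (ι → K)) (w : ι → Fin r → ℤ) :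
    Prop :=
  ∀ t x i, e (ρ t x) i = (torusChar t (w i) : K) * e x i

/-- A coordinate as a polynomial function. -/
def coordFun (e : W ≃ₗ[K] (ι → K)) (i : ι) : polyFun K W :=
  ⟨fun x => e x i, linear_mem_polyFun (LinearMap.proj i ∘ₗ e.toLinearMap)⟩

variable {ρ : Representation K (Fin r → Kˣ) W} {e : W ≃ₗ[K] (ι → K)}

theorem IsDiagonal.coord_eq_zero_iff (h : IsDiagonal ρ e w) {x z : W} (hz : z ∈ repOrbit ρ x)
    (i : ι) : e z i = 0 ↔ e x i = 0 := by
  obtain ⟨t, rfl⟩ := hz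
  simp [h t x i]

theorem IsDiagonal.coord_of_mem_closure {x z : W}
    (h : IsDiagonal ρ e w) (hz : z ∈ zariskiClosure K (repOrbit ρ x)) {i : ι} (hi : e x i = 0) :
    e z i = 0 :=
  hz (coordFun e i) fun _ hy => (h.coord_eq_zero_iff hy i).2 hi

/-- The limit of `x` under the one-parameter subgroup `l`. -/
def limitPt (e : W ≃ₗ[K] (ι → K)) (w : ι → Fin r → ℤ) (l : Fin r → ℤ) (x : W) : W :=
  e.symm fun i => if l ⬝ᵥ w i = 0 then e x i else 0

theorem coord_limitPt (l : Fin r → ℤ) (x : W) (i : ι) :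
    e (limitPt e w l x) i = if l ⬝ᵥ w i = 0 then e x i else 0 := by
  simp [limitPt]

variable [Fintype ι]

theorem prod_zpow_mul_prod_pow {c : ι → ℤ} {z : ι → K} (hz : ∀ i, c i ≠ 0 → z i ≠ 0) :
    (∏ i, z i ^ c i) * ∏ i, z i ^ (-c i).toNat = ∏ i, z i ^ (c i).toNat := by
  rw [← Finset.prod_mul_distrib]
  refine Finset.prod_congr rfl fun i _ => ?_
  by_cases hi : c i = 0
  · simp [hi]
  · rw [← zpow_natCast, ← zpow_natCast, ← zpow_add₀ (hz i hi)]
    congr 1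
    omega

theorem prod_pow_ne_zero {m : ι → ℕ} {z : ι → K} (hz : ∀ i, m i ≠ 0 → z i ≠ 0) :
    ∏ i, z i ^ m i ≠ 0 := by
  refine Finset.prod_ne_zero_iff.2 fun i _ => ?_
  by_cases hi : m i = 0
  · simp [hi]
  · exact pow_ne_zero _ (hz i hi)

/-- Clearing denominators turns an equality of Laurent monomials into a polynomial equation, which
makes sense on the closure of an orbit, where coordinates may vanish. -/
theorem prod_zpow_eq_iff {c : ι → ℤ} {x z : ι → K} (hx : ∀ i, c i ≠ 0 → x i ≠ 0)
    (hz : ∀ i, c i ≠ 0 → z i ≠ 0) :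
    ∏ i, z i ^ c i = ∏ i, x i ^ c i ↔
      (∏ i, z i ^ (c i).toNat) * ∏ i, x i ^ (-c i).toNat =
        (∏ i, z i ^ (-c i).toNat) * ∏ i, x i ^ (c i).toNat := by
  rw [← prod_zpow_mul_prod_pow hx, ← prod_zpow_mul_prod_pow hz]
  have h1 : ∏ i, x i ^ (-c i).toNat ≠ 0 := prod_pow_ne_zero fun i hi => hx i (by omega)
  have h2 : ∏ i, z i ^ (-c i).toNat ≠ 0 := prod_pow_ne_zero fun i hi => hz i (by omega)
  constructor
  · intro h
    rw [h]
    ring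
  · intro h
    refine mul_right_cancel₀ (mul_ne_zero h1 h2) ?_
    linear_combination h

/-- A monomial as a polynomial function. -/
def monomialFun (e : W ≃ₗ[K] (ι → K)) (m : ι → ℕ) : polyFun K W :=
  ∏ i, coordFun e i ^ m i

theorem monomialFun_apply (e : W ≃ₗ[K] (ι → K)) (m : ι → ℕ) (x : W) :
    (monomialFun e m).1 x = ∏ i, e x i ^ m i := by
  rw [← evalAt_apply, monomialFun, map_prod]
  simp [coordFun]

/-- The binomial equation of a relation holds on the closure of an orbit. -/
theorem IsDiagonal.binomial_of_mem_closure (h : IsDiagonal ρ e w) {x z : W}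
    (hz : z ∈ zariskiClosure K (repOrbit ρ x)) {c : ι → ℤ} (hc : IsRel w c) :
    (∏ i, e z i ^ (c i).toNat) * ∏ i, e x i ^ (-c i).toNat =
        (∏ i, e z i ^ (-c i).toNat) * ∏ i, e x i ^ (c i).toNat := by
  have key := hz (monomialFun e (fun i => (c i).toNat) *
      algebraMap K _ (∏ i, e x i ^ (-c i).toNat) -
    monomialFun e (fun i => (-c i).toNat) * algebraMap K _ (∏ i, e x i ^ (c i).toNat)) (by
      rintro _ ⟨t, rfl⟩
      rw [← evalAt_apply, map_sub, map_mul, map_mul, AlgHom.commutes, AlgHom.commutes,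
        evalAt_apply, evalAt_apply, monomialFun_apply, monomialFun_apply]
      simp only [h t x, mul_pow, Finset.prod_mul_distrib, Algebra.algebraMap_self_apply]
      have h1 := congrArg (Units.val) (hc.prod_torusChar t)
      have h2 := prod_zpow_mul_prod_pow (c := c) (z := fun i => (torusChar t (w i) : K))
        fun i _ => Units.ne_zero _
      push_cast at h1
      rw [h1, one_mul] at h2
      rw [h2]
      ring)
  rw [← evalAt_apply, map_sub, map_mul, map_mul, AlgHom.commutes, AlgHom.commutes,
    evalAt_apply, evalAt_apply, monomialFun_apply, monomialFun_apply, sub_eq_zero] at key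
  exact key

theorem subset_zariskiClosure (Z : Set W) : Z ⊆ zariskiClosure K Z := fun z hz _ hf => hf z hz

theorem zariskiClosure_eq_of_isZariskiClosed {Z : Set W} (hZ : IsZariskiClosed K Z) :
    zariskiClosure K Z = Z := by
  refine Set.Subset.antisymm ?_ (subset_zariskiClosure Z)
  obtain ⟨F, rfl⟩ := hZ
  exact fun z hz f hf => hz f fun y hy => hy f hf

theorem isZariskiClosed_of_closure_subset {Z : Set W} (hZ : zariskiClosure K Z ⊆ Z) :
    IsZariskiClosed K Z :=
  ⟨{f | ∀ z ∈ Z, f.1 z = 0}, Set.Subset.antisymm (subset_zariskiClosure Z) hZ⟩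

/-- A polynomial function that is constant on an orbit takes the same value at limit points. -/
theorem IsDiagonal.eq_at_limitPt [Infinite K] (h : IsDiagonal ρ e w) {l : Fin r → ℤ} {x : W}
    (hl : ∀ i, e x i ≠ 0 → 0 ≤ l ⬝ᵥ w i) {f : W → K} (hf : f ∈ polyFun K W) {a : K}
    (hfa : ∀ t, f (ρ t x) = a) : f (limitPt e w l x) = a := by
  classical
  -- The one-parameter subgroup `l` applied to `x`, extended to `τ = 0`. Truncating negative
  -- exponents is harmless: they occur only where `x` vanishes.
  let γ : K → W := fun τ => e.symm fun i => τ ^ (l ⬝ᵥ w i).toNat * e x i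
  have hγ : ∀ l' : Module.Dual K W, ∃ p : K[X], ∀ τ, l' (γ τ) = p.eval τ := fun l' => by
    refine ⟨∑ i, C (l' (e.symm (Pi.single i 1))) * (X ^ (l ⬝ᵥ w i).toNat * C (e x i)), fun τ => ?_⟩
    have : (fun i => τ ^ (l ⬝ᵥ w i).toNat * e x i) =
        ∑ i, (τ ^ (l ⬝ᵥ w i).toNat * e x i) • Pi.single i (1 : K) := by
      funext k
      simp [Finset.sum_apply, Pi.single_apply]
    simp only [γ]
    rw [this]
    simp only [map_sum, map_smul, smul_eq_mul, Polynomial.eval_finsetSum, eval_mul, eval_C,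
      eval_pow, eval_X]
    exact Finset.sum_congr rfl fun i _ => mul_comm _ _
  obtain ⟨p, hp⟩ := exists_polynomial_of_curve hγ hf
  have hγ0 : γ 0 = limitPt e w l x := by
    refine congrArg e.symm (funext fun i => ?_)
    by_cases hi : e x i = 0
    · simp [hi]
    · have := hl i hi
      split_ifs with h0
      · simp [h0]
      · rw [zero_pow (by omega), zero_mul]
  have hγ1 : ∀ τ : K, τ ≠ 0 → p.eval τ = a := by
    intro τ hτ
    rw [← hp, ← hfa fun j => Units.mk0 τ hτ ^ l j]
    congr 1
    refine e.injective (funext fun i => ?_)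
    rw [h, torusChar_cochar]
    simp only [γ, LinearEquiv.apply_symm_apply]
    by_cases hi : e x i = 0
    · simp [hi]
    · rw [Units.val_zpow_eq_zpow_val, Units.val_mk0, ← Int.toNat_of_nonneg (hl i hi),
        zpow_natCast, Int.toNat_natCast]
  have hpa : p - C a = 0 := by
    refine Polynomial.eq_zero_of_infinite_isRoot _
      (Set.Infinite.mono ?_ (Set.finite_singleton (0 : K)).infinite_compl)
    intro τ hτ
    simp [hγ1 τ (by simpa using hτ)]
  rw [← hγ0, hp, sub_eq_zero.1 hpa, eval_C]

theorem IsDiagonal.limitPt_mem_closure [Infinite K] (h : IsDiagonal ρ e w) {l : Fin r → ℤ} {x : W}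
    (hl : ∀ i, e x i ≠ 0 → 0 ≤ l ⬝ᵥ w i) : limitPt e w l x ∈ zariskiClosure K (repOrbit ρ x) :=
  fun f hf => h.eq_at_limitPt hl f.2 fun t => hf _ ⟨t, rfl⟩

variable [IsAlgClosed K]

/-- Orbits of a diagonal torus are cut out by supports and binomials. -/
theorem IsDiagonal.mem_orbit (h : IsDiagonal ρ e w) {x z : W} (hs : ∀ i, e z i = 0 ↔ e x i = 0)
    (hb : ∀ c, IsRel w c → (∀ i, e x i = 0 → c i = 0) → ∏ i, e z i ^ c i = ∏ i, e x i ^ c i) :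
    z ∈ repOrbit ρ x := by
  classical
  let τ : ι → Kˣ := fun i =>
    if hi : e x i = 0 then 1 else Units.mk0 (e z i / e x i) (div_ne_zero (by rwa [Ne, hs]) hi)
  have hτ : ∀ i, e x i ≠ 0 → (τ i : K) = e z i / e x i := fun i hi => by simp [τ, hi]
  obtain ⟨t, ht⟩ := exists_torusChar_eq w τ (fun i => e x i ≠ 0) (by
    intro c hc hcx
    have hcx : ∀ i, e x i = 0 → c i = 0 := fun i hi => hcx i (by simpa using hi)
    refine Units.ext ?_
    push_cast
    have h1 : ∏ i, (τ i : K) ^ c i = (∏ i, e z i ^ c i) / ∏ i, e x i ^ c i := by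
      rw [← Finset.prod_div_distrib]
      refine Finset.prod_congr rfl fun i _ => ?_
      by_cases hi : e x i = 0
      · simp [hcx i hi]
      · rw [hτ i hi, div_zpow]
    rw [h1, hb c hc hcx, div_self]
    refine Finset.prod_ne_zero_iff.2 fun i _ => ?_
    by_cases hi : e x i = 0
    · simp [hcx i hi]
    · exact zpow_ne_zero _ hi)
  refine ⟨t, e.injective (funext fun i => ?_)⟩
  rw [h]
  by_cases hi : e x i = 0
  · rw [hi, (hs i).2 hi, mul_zero]
  · rw [ht i hi, hτ i hi, div_mul_cancel₀ _ hi]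

/-- The orbit of `x` is closed if and only if the weights in the support of `x` satisfy a strictly
positive relation. -/
theorem IsDiagonal.isSemisimpleElt_iff (h : IsDiagonal ρ e w) (x : W) :
    IsSemisimpleElt ρ x ↔ ∃ a, IsRel w a ∧ (∀ i, 0 ≤ a i) ∧ ∀ i, a i ≠ 0 ↔ e x i ≠ 0 := by
  classical
  have : Infinite K := IsAlgClosed.instInfinite
  constructor
  · intro hx
    -- The limit along `l` kills exactly the coordinates of the support of `x` outside that of `a`.
    -- As the orbit is closed, it contains the limit, so no coordinate is killed.
    obtain ⟨a, l, h1, h2, h3, h4, h5⟩ :=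
      exists_rel_dotProduct_complementary w (Finset.univ.filter fun i => e x i ≠ 0)
    have hnn : ∀ i, e x i ≠ 0 → 0 ≤ l ⬝ᵥ w i := fun i hi => by
      by_cases ha : a i = 0
      · exact (h4 i (by simpa using hi) ha).le
      · exact (h5 i (by simpa using hi) ha).ge
    have hlim := h.limitPt_mem_closure hnn
    rw [zariskiClosure_eq_of_isZariskiClosed hx] at hlim
    refine ⟨a, h1, h2, fun i => ⟨fun hi => ?_, fun hi hai => ?_⟩⟩
    · by_contra hxi
      exact hi (h3 i (by simpa using hxi))
    · refine hi ((h.coord_eq_zero_iff hlim i).1 ?_)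
      rw [coord_limitPt, if_neg (h4 i (by simpa using hi) hai).ne']
  · rintro ⟨a, h1, h2, h3⟩
    refine isZariskiClosed_of_closure_subset fun z hz => ?_
    have hneg : ∀ i, (-a i).toNat = 0 := fun i => by have := h2 i; omega
    have hpos : ∀ i, (a i).toNat ≠ 0 ↔ e x i ≠ 0 := fun i => by
      rw [← h3]
      have := h2 i
      omega
    -- The monomial with exponents `a` is invariant and nonzero at `x`, so it is nonzero on the
    -- closure and no coordinate of the support can degenerate to `0`.
    have hs : ∀ i, e z i = 0 ↔ e x i = 0 := by
      refine fun i => ⟨fun hi => ?_, fun hi => h.coord_of_mem_closure hz hi⟩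
      by_contra hxi
      have hb := h.binomial_of_mem_closure hz h1
      simp only [hneg, pow_zero, Finset.prod_const_one, mul_one, one_mul] at hb
      refine prod_pow_ne_zero (fun i hi => (hpos i).1 hi) (hb.symm.trans ?_)
      exact Finset.prod_eq_zero (Finset.mem_univ i) (by rw [hi, zero_pow ((hpos i).2 hxi)])
    refine h.mem_orbit hs fun c hc hcx => ?_
    have hx' : ∀ i, c i ≠ 0 → e x i ≠ 0 := fun i hi hxi => hi (hcx i hxi)
    rw [prod_zpow_eq_iff hx' fun i hi => by rw [Ne, hs]; exact hx' i hi]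
    exact h.binomial_of_mem_closure hz hc

/-- Visibility of a diagonal representation in terms of its weights. -/
theorem IsDiagonal.isVisible_iff [CharZero K] (h : IsDiagonal ρ e w) :
    IsVisible ρ ↔ PositivelyDependent w := by
  classical
  have : Infinite K := IsAlgClosed.instInfinite
  constructor
  · intro hvis c hc hc0
    by_contra! hcon
    -- Without a nonnegative relation inside the support of `c`, complementarity gives a form `l`
    -- that is strictly positive on this support; all vectors supported there are then nilpotent.
    obtain ⟨a, l, h1, h2, h3, h4, h5⟩ :=
      exists_rel_dotProduct_complementary w (Finset.univ.filter fun i => c i ≠ 0)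
    have ha : a = 0 := by
      by_contra ha
      obtain ⟨i, hi, hai⟩ := hcon a h1 ha h2
      exact hai (h3 i (by simpa using hi))
    have hl : ∀ i, c i ≠ 0 → 0 < l ⬝ᵥ w i := fun i hi => h4 i (by simpa using hi) (by simp [ha])
    obtain ⟨k, hk⟩ := Function.ne_iff.1 hc0
    have hk : c k ≠ 0 := hk
    let x : Kˣ → W := fun τ => e.symm fun i => if i = k then (τ : K) else if c i = 0 then 0 else 1
    have hx : ∀ τ i, e (x τ) i = if i = k then (τ : K) else if c i = 0 then 0 else 1 :=
      fun τ i => by simp [x]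
    have hx0 : ∀ τ i, e (x τ) i ≠ 0 ↔ c i ≠ 0 := fun τ i => by
      rw [hx]
      by_cases hik : i = k
      · simp [hik, hk]
      · by_cases hci : c i = 0 <;> simp [hik, hci]
    have hnil : ∀ τ, IsNilpotentElt ρ (x τ) := fun τ => by
      have hlim := h.limitPt_mem_closure (l := l) (x := x τ) fun i hi => (hl i ((hx0 τ i).1 hi)).le
      suffices h0 : limitPt e w l (x τ) = 0 by rwa [h0] at hlim
      refine e.symm_apply_eq.2 ?_
      rw [map_zero]
      funext i
      by_cases hci : c i = 0
      · rw [not_not.1 (mt (hx0 τ i).1 (not_not.2 hci))]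
        simp
      · rw [if_neg (hl i hci).ne']
        rfl
    -- The Laurent monomial of `c` is constant on orbits and takes the value `τ ^ c k` at `x τ`.
    -- These values exhaust the infinite group of units, so there are infinitely many orbits.
    have hinv : ∀ τ τ', repOrbit ρ (x τ) = repOrbit ρ (x τ') → τ ^ c k = τ' ^ c k := by
      intro τ τ' hττ
      have hmem : x τ ∈ repOrbit ρ (x τ') := hττ ▸ ⟨1, by simp⟩
      have h6 := h.binomial_of_mem_closure (subset_zariskiClosure _ hmem) hc
      rw [← prod_zpow_eq_iff (fun i hi => (hx0 _ i).2 hi) (fun i hi => (hx0 _ i).2 hi)] at h6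
      have h7 : ∀ τ : Kˣ, ∏ i, e (x τ) i ^ c i = (τ : K) ^ c k := fun τ => by
        rw [Finset.prod_eq_single k]
        · rw [hx, if_pos rfl]
        · intro i _ hik
          rw [hx, if_neg hik]
          by_cases hci : c i = 0 <;> simp [hci]
        · simp
      rw [h7, h7] at h6
      exact Units.ext (by push_cast; exact h6)
    have hfin : (Set.range fun τ => repOrbit ρ (x τ)).Finite :=
      hvis.subset (by rintro _ ⟨τ, rfl⟩; exact ⟨x τ, hnil τ, rfl⟩)
    have hfin2 : (Set.range fun τ : Kˣ => τ ^ c k).Finite := by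
      have : (fun τ : Kˣ => τ ^ c k) =
          (fun O => (Function.invFun (fun τ => repOrbit ρ (x τ)) O) ^ c k) ∘
            fun τ => repOrbit ρ (x τ) := by
        funext τ
        exact hinv _ _ (Function.invFun_eq (f := fun τ => repOrbit ρ (x τ)) ⟨τ, rfl⟩).symm
      rw [this, Set.range_comp]
      exact hfin.image _
    rw [(units_zpow_surjective hk).range_eq] at hfin2
    have : Infinite Kˣ := Infinite.of_injective
      (fun n : ℕ => Units.mk0 ((n : K) + 1) (Nat.cast_add_one_ne_zero n)) fun m n hmn => by
        simpa using congrArg Units.val hmn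
    exact Set.infinite_univ hfin2
  · intro hpd
    have key : ∀ x, IsNilpotentElt ρ x → repOrbit ρ x = {z | ∀ i, e z i = 0 ↔ e x i = 0} := by
      intro x hx
      -- A nonzero nonnegative relation on the support of `x` would give an invariant monomial that
      -- is nonzero at `x` and zero at `0`. So there are no binomial conditions, and a nilpotent
      -- orbit is determined by its support.
      have hno : ∀ c, IsRel w c → (∀ i, e x i = 0 → c i = 0) → c = 0 := by
        intro c hc hcx
        by_contra hc0
        obtain ⟨a, h1, h2, h3, h4⟩ := hpd c hc hc0
        have hneg : ∀ i, (-a i).toNat = 0 := fun i => by have := h3 i; omega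
        have hb := h.binomial_of_mem_closure hx h1
        simp only [hneg, pow_zero, Finset.prod_const_one, mul_one, one_mul, map_zero,
          Pi.zero_apply] at hb
        obtain ⟨k, hk⟩ := Function.ne_iff.1 h2
        have hk : a k ≠ 0 := hk
        refine prod_pow_ne_zero (m := fun i => (a i).toNat) (z := e x) (fun i hi hxi => hi ?_)
          (hb.symm.trans (Finset.prod_eq_zero (Finset.mem_univ k) (zero_pow ?_)))
        · rw [h4 i (hcx i hxi), Int.toNat_zero]
        · have := h3 k
          omega
      refine Set.Subset.antisymm (fun z hz i => h.coord_eq_zero_iff hz i) fun z hz =>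
        h.mem_orbit hz fun c hc hcx => ?_
      simp [hno c hc hcx]
    refine (Set.finite_range fun I : Set ι => {z | ∀ i, e z i = 0 ↔ i ∈ I}).subset ?_
    rintro _ ⟨x, hx, rfl⟩
    exact ⟨{i | e x i = 0}, (key x hx).symm⟩

end Diagonal

/-! ### Closed orbits in the null fibre -/

section NullFibre

universe u

variable {K : Type u} [Field K] {r n : ℕ} {s : Fin n → Fin r → ℤ}

/-- The coordinates of a linear form on `K^n`. -/
def dualCoord (K : Type u) [Field K] (n : ℕ) : Module.Dual K (Fin n → K) ≃ₗ[K] (Fin n → K) :=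
  ((Pi.basisFun K (Fin n)).constr K).symm

theorem dualCoord_apply (y : Module.Dual K (Fin n → K)) (i : Fin n) :
    dualCoord K n y i = y (Pi.single i 1) := by
  simp [dualCoord, Module.Basis.constr]

theorem apply_eq_sum_dualCoord (y : Module.Dual K (Fin n → K)) (x : Fin n → K) :
    y x = ∑ i, x i * dualCoord K n y i := by
  conv_lhs => rw [← (Pi.basisFun K (Fin n)).sum_repr x, map_sum]
  refine Finset.sum_congr rfl fun i _ => ?_
  rw [map_smul, smul_eq_mul, dualCoord_apply]
  simp

/-- The coordinates on `V ⊕ V*`. -/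
def prodCoord (K : Type u) [Field K] (n : ℕ) :
    ((Fin n → K) × Module.Dual K (Fin n → K)) ≃ₗ[K] (Fin n ⊕ Fin n → K) :=
  ((LinearEquiv.refl K (Fin n → K)).prodCongr (dualCoord K n)).trans
    (LinearEquiv.sumArrowLequivProdArrow (Fin n) (Fin n) K K).symm

@[simp]
theorem prodCoord_inl (z : (Fin n → K) × Module.Dual K (Fin n → K)) (i : Fin n) :
    prodCoord K n z (Sum.inl i) = z.1 i := rfl

@[simp]
theorem prodCoord_inr (z : (Fin n → K) × Module.Dual K (Fin n → K)) (i : Fin n) :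
    prodCoord K n z (Sum.inr i) = dualCoord K n z.2 i := rfl

theorem torusRep_apply (t : Fin r → Kˣ) (x : Fin n → K) (i : Fin n) :
    torusRep K s t x i = (torusChar t (s i) : K) * x i := by
  simp [torusRep, torusChar]

theorem torusLie_apply (h : Fin r → K) (x : Fin n → K) (i : Fin n) :
    torusLie K s h x i = (∑ j, (s i j : K) * h j) * x i := rfl

theorem isDiagonal_torusRep (s : Fin n → Fin r → ℤ) :
    IsDiagonal (torusRep K s) (LinearEquiv.refl K (Fin n → K)) s :=
  torusRep_apply

theorem isDiagonal_dual (s : Fin n → Fin r → ℤ) :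
    IsDiagonal (torusRep K s).dual (dualCoord K n) (-s) := fun t y i => by
  rw [dualCoord_apply, dualCoord_apply, Representation.dual_apply, Module.Dual.transpose_apply,
    LinearMap.comp_apply]
  have : torusRep K s t⁻¹ (Pi.single i 1) = (torusChar t (-s i) : K) • Pi.single i 1 := by
    funext k
    rw [torusRep_apply, torusChar_inv, ← torusChar_neg]
    by_cases hk : k = i
    · subst hk; simp
    · simp [hk]
  rw [this, map_smul, smul_eq_mul]
  rfl

theorem isDiagonal_doubleRep (s : Fin n → Fin r → ℤ) :
    IsDiagonal (doubleRep (torusRep K s)) (prodCoord K n) (Sum.elim s (-s)) := by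
  rintro t z (i | i)
  · exact isDiagonal_torusRep s t z.1 i
  · exact isDiagonal_dual s t z.2 i

theorem isRel_neg_iff {c : Fin n → ℤ} : IsRel (-s) c ↔ IsRel s c := by
  simp [IsRel]

theorem isRel_sumElim_iff {a : Fin n ⊕ Fin n → ℤ} :
    IsRel (Sum.elim s (-s)) a ↔ IsRel s fun i => a (Sum.inl i) - a (Sum.inr i) := by
  simp [IsRel, sub_mul, Finset.sum_sub_distrib, Fintype.sum_sum_type, ← sub_eq_add_neg]

theorem momentMap_apply (z : (Fin n → K) × Module.Dual K (Fin n → K)) (h : Fin r → K) :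
    momentMap (torusLie K s) z h =
      ∑ j, h j * ∑ i, z.1 i * dualCoord K n z.2 i * (s i j : K) := by
  change z.2 (torusLie K s h z.1) = _
  rw [apply_eq_sum_dualCoord]
  simp only [torusLie_apply, Finset.mul_sum, Finset.sum_mul]
  rw [Finset.sum_comm]
  exact Finset.sum_congr rfl fun j _ => Finset.sum_congr rfl fun i _ => by ring

/-- Pairing `h · x` with the form gives the weighted sum of the products of coordinates, and `h` is
arbitrary. -/
theorem mem_nullFibre_iff {z : (Fin n → K) × Module.Dual K (Fin n → K)} :
    z ∈ nullFibre (torusLie K s) ↔ (fun i => z.1 i * dualCoord K n z.2 i) ∈ relSpace K s := by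
  constructor
  · intro h j
    have := LinearMap.congr_fun (show momentMap (torusLie K s) z = 0 from h) (Pi.single j 1)
    rw [momentMap_apply] at this
    simpa [Pi.single_apply] using this
  · intro h
    refine LinearMap.ext fun x => ?_
    rw [momentMap_apply]
    refine Finset.sum_eq_zero fun j _ => ?_
    rw [show ∑ i, z.1 i * dualCoord K n z.2 i * (s i j : K) = 0 from h j, mul_zero]

/-- The point of the null fibre over a relation `u` and a vector `p` with nonzero coordinates on
the support of `u`. -/
def relPoint (u p : Fin n → K) : (Fin n → K) × Module.Dual K (Fin n → K) :=
  (p, (dualCoord K n).symm fun i => u i / p i)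

theorem relPoint_mem_nullFibre {u p : Fin n → K} (hu : u ∈ relSpace K s)
    (hp : ∀ i, p i ≠ 0 ↔ u i ≠ 0) : relPoint u p ∈ nullFibre (torusLie K s) := by
  rw [mem_nullFibre_iff]
  convert hu using 2 with i
  by_cases hi : p i = 0
  · have : u i = 0 := not_not.1 (mt (hp i).2 (not_not.2 hi))
    simp [relPoint, hi, this]
  · simp [relPoint, mul_div_cancel₀ _ hi]

theorem repOrbit_fst {z z' : (Fin n → K) × Module.Dual K (Fin n → K)}
    (h : repOrbit (doubleRep (torusRep K s)) z = repOrbit (doubleRep (torusRep K s)) z') :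
    repOrbit (torusRep K s) z.1 = repOrbit (torusRep K s) z'.1 := by
  have key : ∀ z : (Fin n → K) × Module.Dual K (Fin n → K),
      repOrbit (torusRep K s) z.1 = Prod.fst '' repOrbit (doubleRep (torusRep K s)) z := fun z => by
    rw [repOrbit, repOrbit, ← Set.range_comp]
    rfl
  rw [key, key, h]

variable [IsAlgClosed K]

theorem isSemisimpleElt_torusRep_iff {x : Fin n → K} : IsSemisimpleElt (torusRep K s) x ↔
    ∃ a, IsRel s a ∧ (∀ i, 0 ≤ a i) ∧ ∀ i, a i ≠ 0 ↔ x i ≠ 0 :=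
  (isDiagonal_torusRep s).isSemisimpleElt_iff x

theorem isSemisimpleElt_dual_iff {y : Module.Dual K (Fin n → K)} :
    IsSemisimpleElt (torusRep K s).dual y ↔
      ∃ a, IsRel s a ∧ (∀ i, 0 ≤ a i) ∧ ∀ i, a i ≠ 0 ↔ dualCoord K n y i ≠ 0 := by
  rw [(isDiagonal_dual s).isSemisimpleElt_iff]
  simp only [isRel_neg_iff]

/-- The weights on `V ⊕ V*` are `s` and `-s`, so a relation is a pair `a, b` with `a - b` a relation
of `s`. -/
theorem isSemisimpleElt_double_iff {z : (Fin n → K) × Module.Dual K (Fin n → K)} :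
    IsSemisimpleElt (doubleRep (torusRep K s)) z ↔
      ∃ a b : Fin n → ℤ, IsRel s (a - b) ∧ (∀ i, 0 ≤ a i) ∧ (∀ i, 0 ≤ b i) ∧
        (∀ i, a i ≠ 0 ↔ z.1 i ≠ 0) ∧ ∀ i, b i ≠ 0 ↔ dualCoord K n z.2 i ≠ 0 := by
  rw [(isDiagonal_doubleRep s).isSemisimpleElt_iff]
  constructor
  · rintro ⟨a, h1, h2, h3⟩
    exact ⟨fun i => a (Sum.inl i), fun i => a (Sum.inr i), isRel_sumElim_iff.1 h1,
      fun i => h2 _, fun i => h2 _, fun i => h3 (Sum.inl i), fun i => h3 (Sum.inr i)⟩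
  · rintro ⟨a, b, h1, h2, h3, h4, h5⟩
    refine ⟨Sum.elim a b, isRel_sumElim_iff.2 h1, ?_, ?_⟩
    · rintro (i | i)
      exacts [h2 i, h3 i]
    · rintro (i | i)
      exacts [h4 i, h5 i]

theorem isSemisimpleElt_double_of {x : Fin n → K} {y : Module.Dual K (Fin n → K)}
    (hx : IsSemisimpleElt (torusRep K s) x) (hy : IsSemisimpleElt (torusRep K s).dual y) :
    IsSemisimpleElt (doubleRep (torusRep K s)) (x, y) := by
  obtain ⟨a, h1, h2, h3⟩ := isSemisimpleElt_torusRep_iff.1 hx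
  obtain ⟨b, h4, h5, h6⟩ := isSemisimpleElt_dual_iff.1 hy
  exact isSemisimpleElt_double_iff.2
    ⟨a, b, by simpa [sub_eq_add_neg] using h1.add h4.neg, h2, h5, h3, h6⟩

/-- Where both components are nonzero, the moment map equation supplies a relation over `K`, hence a
nonnegative one (`both`). Where only one is nonzero, `a - b` or `b - a` is positive there, and its
positive part is covered by nonnegative relations (`side`). Their sum has the required support. -/
theorem PositivelyDependent.isSemisimpleElt_fst_snd [CharZero K] (hs : PositivelyDependent s)
    {z : (Fin n → K) × Module.Dual K (Fin n → K)} (hz : z ∈ nullFibre (torusLie K s))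
    (hc : IsSemisimpleElt (doubleRep (torusRep K s)) z) :
    IsSemisimpleElt (torusRep K s) z.1 ∧ IsSemisimpleElt (torusRep K s).dual z.2 := by
  obtain ⟨a, b, hab, ha, hb, haz, hbz⟩ := isSemisimpleElt_double_iff.1 hc
  rw [mem_nullFibre_iff] at hz
  have both : ∀ i, z.1 i ≠ 0 → dualCoord K n z.2 i ≠ 0 → ∃ d, IsRel s d ∧ (∀ j, 0 ≤ d j) ∧
      (∀ j, z.1 j * dualCoord K n z.2 j = 0 → d j = 0) ∧ 0 < d i := by
    intro i h1 h2
    obtain ⟨c, hc, hc0, hci⟩ := exists_int_rel_of_ne_zero hz (i := i) (mul_ne_zero h1 h2)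
    obtain ⟨d, h1, h2, h3, h4⟩ := hs.exists_nonneg_of_ne_zero hc hci
    exact ⟨d, h1, h2, fun j hj => h3 j (hc0 j hj), h4⟩
  have side : ∀ a b : Fin n → ℤ, IsRel s (a - b) → (∀ i, 0 ≤ a i) → (∀ i, 0 ≤ b i) →
      ∀ i, a i ≠ 0 → b i = 0 → ∃ d, IsRel s d ∧ (∀ j, 0 ≤ d j) ∧
      (∀ j, a j = 0 → d j = 0) ∧ 0 < d i := by
    intro a b hab ha hb i h1 h2
    obtain ⟨d, h3, h4, h5, h6⟩ := hs.exists_nonneg_of_pos hab (i := i) (by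
      have := (ha i).lt_of_ne' h1
      simpa [h2] using this)
    refine ⟨d, h3, h4, fun j hj => h5 j ?_, h6⟩
    have := hb j
    simp [hj, this]
  constructor
  · rw [isSemisimpleElt_torusRep_iff]
    refine exists_rel_support_eq _ fun i hi => ?_
    by_cases hyi : dualCoord K n z.2 i = 0
    · obtain ⟨d, h1, h2, h3, h4⟩ := side a b hab ha hb i ((haz i).2 hi)
        (not_not.1 (mt (hbz i).1 (not_not.2 hyi)))
      exact ⟨d, h1, h2, fun j hj => h3 j (not_not.1 (mt (haz j).1 hj)), h4⟩
    · obtain ⟨d, h1, h2, h3, h4⟩ := both i hi hyi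
      exact ⟨d, h1, h2, fun j hj => h3 j (by rw [not_not.1 hj, zero_mul]), h4⟩
  · rw [isSemisimpleElt_dual_iff]
    refine exists_rel_support_eq _ fun i hi => ?_
    by_cases hxi : z.1 i = 0
    · obtain ⟨d, h1, h2, h3, h4⟩ := side b a (by simpa using hab.neg) hb ha i ((hbz i).2 hi)
        (not_not.1 (mt (haz i).1 (not_not.2 hxi)))
      exact ⟨d, h1, h2, fun j hj => h3 j (not_not.1 (mt (hbz j).1 hj)), h4⟩
    · obtain ⟨d, h1, h2, h3, h4⟩ := both i hxi hi
      exact ⟨d, h1, h2, fun j hj => h3 j (by rw [not_not.1 hj, mul_zero]), h4⟩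

theorem isVisible_torusRep_iff [CharZero K] :
    IsVisible (torusRep K s) ↔ PositivelyDependent s :=
  (isDiagonal_torusRep s).isVisible_iff

/-- The two components have the same support, so its indicator can be taken for both `a` and `b`,
and the difference is the trivial relation. -/
theorem isSemisimpleElt_relPoint {u p : Fin n → K}
    (hp : ∀ i, p i ≠ 0 ↔ u i ≠ 0) :
    IsSemisimpleElt (doubleRep (torusRep K s)) (relPoint u p) := by
  classical
  rw [isSemisimpleElt_double_iff]
  refine ⟨fun i => if p i = 0 then 0 else 1, fun i => if p i = 0 then 0 else 1, ?_, ?_, ?_, ?_, ?_⟩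
  · rw [sub_self]
    exact isRel_zero
  · intro i
    dsimp only
    split_ifs <;> simp
  · intro i
    dsimp only
    split_ifs <;> simp
  · intro i
    simp [relPoint]
  · intro i
    by_cases hi : p i = 0
    · simp [relPoint, hi]
    · simp [relPoint, hi, (hp i).1 hi]

theorem isVisible_iff_closed_orbits [CharZero K] (s : Fin n → Fin r → ℤ) :
    IsVisible (torusRep K s) ↔
      {O : Set ((Fin n → K) × Module.Dual K (Fin n → K)) |
          ∃ z ∈ nullFibre (torusLie K s),
            O = repOrbit (doubleRep (torusRep K s)) z ∧ IsZariskiClosed K O} =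
        {O : Set ((Fin n → K) × Module.Dual K (Fin n → K)) |
          ∃ x y, (x, y) ∈ nullFibre (torusLie K s) ∧
            O = repOrbit (doubleRep (torusRep K s)) (x, y) ∧
            IsSemisimpleElt (torusRep K s) x ∧ IsSemisimpleElt (torusRep K s).dual y} := by
  rw [isVisible_torusRep_iff]
  constructor
  · intro hs
    ext O
    constructor
    · rintro ⟨z, hz, rfl, hc⟩
      obtain ⟨h1, h2⟩ := hs.isSemisimpleElt_fst_snd hz hc
      exact ⟨z.1, z.2, hz, rfl, h1, h2⟩
    · rintro ⟨x, y, hz, rfl, hx, hy⟩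
      exact ⟨_, hz, rfl, isSemisimpleElt_double_of hx hy⟩
  · intro h
    by_contra hs
    simp only [PositivelyDependent, not_forall] at hs
    obtain ⟨c, hc, hc0, hcon⟩ := hs
    classical
    let p : Fin n → K := fun i => if c i = 0 then 0 else 1
    have hpc : ∀ i, p i ≠ 0 ↔ c i ≠ 0 := fun i => by simp [p]
    have hp : ∀ i, p i ≠ 0 ↔ (c i : K) ≠ 0 := fun i => by simp [p]
    have hmem : repOrbit (doubleRep (torusRep K s)) (relPoint (fun i => (c i : K)) p) ∈
        {O : Set ((Fin n → K) × Module.Dual K (Fin n → K)) |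
          ∃ z ∈ nullFibre (torusLie K s),
            O = repOrbit (doubleRep (torusRep K s)) z ∧ IsZariskiClosed K O} :=
      -- The closed orbit to test is that of the point whose product vector is the offending
      -- relation `c`. A closed orbit of its first component would give a nonnegative relation with
      -- the support of `c`.
      ⟨_, relPoint_mem_nullFibre (intCast_mem_relSpace hc) hp, rfl, isSemisimpleElt_relPoint hp⟩
    rw [h] at hmem
    obtain ⟨x, y, -, hO, hx, -⟩ := hmem
    have hpx : IsSemisimpleElt (torusRep K s) p := by
      have := repOrbit_fst hO
      rw [IsSemisimpleElt]
      rwa [IsSemisimpleElt, ← this] at hx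
    obtain ⟨a, h1, h2, h3⟩ := isSemisimpleElt_torusRep_iff.1 hpx
    refine hcon ⟨a, h1, fun ha => hc0 ?_, h2, fun i hi => ?_⟩
    · funext i
      by_contra hi
      exact (h3 i).2 ((hpc i).2 hi) (congrFun ha i)
    · by_contra hai
      exact (hpc i).1 ((h3 i).1 hai) hi

end NullFibre

/-! ### The dimension of the categorical quotient -/

section QuotientDim

universe u

variable {K : Type u} [Field K] {r n : ℕ} {s : Fin n → Fin r → ℤ}

theorem linear_eq_sum {W : Type*} [AddCommGroup W] [Module K W] {ι : Type*} [Fintype ι]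
    [DecidableEq ι] (l : (ι → K) →ₗ[K] W) (x : ι → K) : l x = ∑ i, x i • l (Pi.single i 1) := by
  conv_lhs => rw [← (Pi.basisFun K ι).sum_repr x, map_sum]
  simp

/-- An affine map is polynomial. -/
theorem isPolyMap_affine {W W₀ : Type u} [AddCommGroup W] [Module K W] [AddCommGroup W₀]
    [Module K W₀] (x : W) (L : W₀ →ₗ[K] W) : IsPolyMap K fun w => x + L w := fun l => by
  simp only [map_add]
  exact (polyFun K W₀).add_mem (const_mem_polyFun (l x)) (linear_mem_polyFun (l ∘ₗ L))

variable (K s) in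
/-- The relations with support in the set defined by `p`. -/
def relSpaceOn (p : Fin n → Prop) : Submodule K (Fin n → K) :=
  relSpace K s ⊓
    { carrier := {u | ∀ i, ¬ p i → u i = 0}
      zero_mem' := fun _ _ => rfl
      add_mem' := fun ha hb i hi => by simp [ha i hi, hb i hi]
      smul_mem' := fun k a ha i hi => by simp [ha i hi] }

variable (K s) in
/-- A maximal subset `B` of `p` that supports no relation: each element of `p` outside `B`
completes `B` to the support of a relation. -/
theorem exists_maximal_independent (p : Fin n → Prop) :
    ∃ B : Finset (Fin n), (∀ i ∈ B, p i) ∧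
      (∀ u ∈ relSpace K s, (∀ i ∉ B, u i = 0) → u = 0) ∧
      ∀ i, p i → i ∉ B → ∃ u ∈ relSpace K s, u i = 1 ∧ ∀ j ∉ B, j ≠ i → u j = 0 := by
  classical
  obtain ⟨B, hB, hmax⟩ := Finset.exists_max_image
    (Finset.univ.filter fun B : Finset (Fin n) => (∀ i ∈ B, p i) ∧
      ∀ u ∈ relSpace K s, (∀ i ∉ B, u i = 0) → u = 0) Finset.card
    ⟨∅, by
      simp only [Finset.mem_filter, Finset.mem_univ, Finset.notMem_empty, true_and]
      exact ⟨fun i hi => hi.elim, fun u _ hu => funext fun i => hu i not_false⟩⟩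
  simp only [Finset.mem_filter, Finset.mem_univ, true_and] at hB hmax
  refine ⟨B, hB.1, hB.2, fun i hi hiB => ?_⟩
  have hnot : ¬ ((∀ j ∈ insert i B, p j) ∧
      ∀ u ∈ relSpace K s, (∀ j ∉ insert i B, u j = 0) → u = 0) := fun h => by
    have := hmax _ h
    rw [Finset.card_insert_of_notMem hiB] at this
    omega
  have h1 : ∀ j ∈ insert i B, p j := fun j hj => by
    rcases Finset.mem_insert.1 hj with rfl | hj
    exacts [hi, hB.1 j hj]
  simp only [not_and, not_forall] at hnot
  obtain ⟨u, hu, hu0, hune⟩ := hnot h1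
  have hui : u i ≠ 0 := fun h => hune (hB.2 u hu fun j hj => by
    by_cases hji : j = i
    · rw [hji, h]
    · exact hu0 j (by simp [hji, hj]))
  refine ⟨(u i)⁻¹ • u, Submodule.smul_mem _ _ hu, by simp [hui], fun j hj hji => ?_⟩
  simp [hu0 j (by simp [hji, hj])]

variable [IsAlgClosed K] [CharZero K]

/-- The dimension of `V // T` is at most the dimension of the space of relations with support in
the largest support of a nonnegative relation. -/
theorem trdeg_invariantFun_le (s : Fin n → Fin r → ℤ) :
    ∃ a, IsRel s a ∧ (∀ i, 0 ≤ a i) ∧ Algebra.trdeg K (invariantFun (torusRep K s)) ≤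
      Module.finrank K (relSpaceOn K s fun i => a i ≠ 0) := by
  classical
  have : Infinite K := IsAlgClosed.instInfinite
  obtain ⟨a, l, h1, h2, h3, h4, h5⟩ := exists_rel_dotProduct_complementary s Finset.univ
  have h4 : ∀ i, a i = 0 → 0 < l ⬝ᵥ s i := fun i => h4 i (Finset.mem_univ i)
  have h5 : ∀ i, a i ≠ 0 → l ⬝ᵥ s i = 0 := fun i => h5 i (Finset.mem_univ i)
  refine ⟨a, h1, h2, ?_⟩
  obtain ⟨B, hBp, hBind, hBmax⟩ := exists_maximal_independent K s fun i => a i ≠ 0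
  choose! v hv hvi hv0 using hBmax
  -- The slice is `b + U`: coordinates in `B` are normalised to `1`, those in the support of `a`
  -- outside `B` are free, and the others are `0`.
  let U : Submodule K (Fin n → K) :=
    { carrier := {x | ∀ i, ¬ (a i ≠ 0 ∧ i ∉ B) → x i = 0}
      zero_mem' := fun _ _ => rfl
      add_mem' := fun ha hb i hi => by simp [ha i hi, hb i hi]
      smul_mem' := fun k a ha i hi => by simp [ha i hi] }
  have hfin : Module.finrank K U ≤ Module.finrank K (relSpaceOn K s fun i => a i ≠ 0) := by
    -- Each free coordinate `i` comes with its fundamental relation `v i`, which is `1` at `i` and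
    -- `0` at the other free coordinates.
    let Φ : U →ₗ[K] (Fin n → K) := Fintype.linearCombination K v ∘ₗ U.subtype
    have hΦ : ∀ x : U, Φ x = ∑ i, x.1 i • v i := fun x => by
      simp [Φ, Fintype.linearCombination_apply]
    have hmem : ∀ x, Φ x ∈ relSpaceOn K s fun i => a i ≠ 0 := fun x => by
      rw [hΦ]
      refine Submodule.sum_mem _ fun i _ => ?_
      by_cases hi : a i ≠ 0 ∧ i ∉ B
      · refine Submodule.smul_mem _ _ ⟨hv i hi.1 hi.2, fun j hj => ?_⟩
        exact hv0 i hi.1 hi.2 j (fun hjB => hj (hBp j hjB)) (by rintro rfl; exact hj hi.1)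
      · rw [x.2 i hi, zero_smul]
        exact zero_mem _
    refine LinearMap.finrank_le_finrank_of_injective (f := Φ.codRestrict _ hmem) ?_
    rw [injective_iff_map_eq_zero]
    intro x hx
    have hx : Φ x = 0 := congrArg Subtype.val hx
    refine Subtype.ext (funext fun i => ?_)
    by_cases hi : a i ≠ 0 ∧ i ∉ B
    · have := congrFun hx i
      rw [hΦ, Finset.sum_apply, Finset.sum_eq_single i] at this
      · simpa [hvi i hi.1 hi.2] using this
      · intro k _ hki
        by_cases hk : a k ≠ 0 ∧ k ∉ B
        · simp [hv0 k hk.1 hk.2 i hi.2 hki.symm]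
        · simp [x.2 k hk]
      · simp
    · exact x.2 i hi
  let b : Fin n → K := fun i => if i ∈ B then 1 else 0
  refine (trdeg_le_of_slice _ (isPolyMap_affine b U.subtype) ?_).trans (by exact_mod_cast hfin)
  intro f hf hfU
  have hinv : ∀ t x, f.1 (torusRep K s t x) = f.1 x := fun t x =>
    congrFun (congrArg Subtype.val (hf t)) x
  have step1 : ∀ x : Fin n → K, (∀ i, a i = 0 → x i = 0) → (∀ i ∈ B, x i ≠ 0) → f.1 x = 0 := by
    intro x hx hxB
    obtain ⟨t, ht⟩ := exists_torusChar_eq s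
      (fun i => if h : x i = 0 then 1 else (Units.mk0 (x i) h)⁻¹) (fun i => i ∈ B) (by
        intro c hc hcB
        have := hBind _ (intCast_mem_relSpace hc) fun i hi => by simp [hcB i hi]
        have hc0 : c = 0 := funext fun i => by simpa using congrFun this i
        simp [hc0])
    have hmem : torusRep K s t x - b ∈ U := by
      intro i hi
      rw [Pi.sub_apply, torusRep_apply]
      by_cases hiB : i ∈ B
      · simp [b, hiB, ht i hiB, hxB i hiB]
      · simp [b, hiB, hx i (by tauto)]
    rw [← hinv t x, ← hfU ⟨_, hmem⟩]
    simp
  have step2 : ∀ x : Fin n → K, (∀ i, a i = 0 → x i = 0) → f.1 x = 0 := by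
    intro x hx
    -- Moving in the direction `b` makes the coordinates in `B` nonzero for all but finitely many
    -- parameters, so `step1` applies generically.
    refine eq_zero_of_line f.2 x b ((Finset.univ.image fun i => -x i).finite_toSet.subset ?_)
    intro τ hτ
    by_contra hcon
    refine hτ (step1 _ (fun i hi => ?_) fun i hi h0 => hcon ?_)
    · have : i ∉ B := fun h => hBp i h hi
      simp [hx i hi, b, this]
    · simp only [Pi.add_apply, Pi.smul_apply, b, hi, if_true, smul_eq_mul, mul_one] at h0
      simp only [Finset.coe_image, Finset.coe_univ, Set.image_univ, Set.mem_range]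
      exact ⟨i, by linear_combination -h0⟩
  refine Subtype.ext (funext fun x => ?_)
  -- Letting `l` contract the coordinates outside the support of `a` does not change the value of an
  -- invariant function.
  have hlim := (isDiagonal_torusRep (K := K) s).eq_at_limitPt (l := l) (x := x) (fun i _ => by
    by_cases hi : a i = 0
    · exact (h4 i hi).le
    · exact (h5 i hi).ge) f.2 fun t => hinv t x
  rw [← hlim]
  refine step2 _ fun i hi => ?_
  have := coord_limitPt (e := LinearEquiv.refl K (Fin n → K)) (w := s) l x i
  rw [if_neg (h4 i hi).ne'] at this
  exact this

end QuotientDim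

/-! ### Cartan subspaces of torus representations -/

section Cartan

universe u

variable {K : Type u} [Field K] {r n : ℕ} {s : Fin n → Fin r → ℤ} {v : Fin n → K}

theorem mem_cartanOf_iff {x : Fin n → K} : x ∈ cartanOf (torusLie K s) v ↔
    ∀ h : Fin r → K, ∃ h' : Fin r → K, ∀ i,
      (∑ j, (s i j : K) * h' j) * v i = (∑ j, (s i j : K) * h j) * x i := by
  constructor
  · intro hx h
    obtain ⟨h', hh'⟩ := hx ⟨h, rfl⟩
    exact ⟨h', fun i => congrFun hh' i⟩
  · rintro hx _ ⟨h, rfl⟩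
    obtain ⟨h', hh'⟩ := hx h
    exact ⟨h', funext hh'⟩

/-- The coordinates of `v` of weight `0` may be changed. -/
theorem cartanOf_eq_of_weight_zero [DecidableEq (Fin r → ℤ)] (v : Fin n → K) :
    cartanOf (torusLie K s) v = cartanOf (torusLie K s) fun i => if s i = 0 then 1 else v i := by
  ext x
  simp only [mem_cartanOf_iff]
  refine forall_congr' fun h => exists_congr fun h' => forall_congr' fun i => ?_
  by_cases hi : s i = 0 <;> simp [hi]

/-- The quotients `x / v`, for `x` in `cartanOf v`, act on the relations supported on `v`. -/
theorem mul_div_mem_relSpace {x u : Fin n → K} (hx : x ∈ cartanOf (torusLie K s) v)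
    (hu : u ∈ relSpace K s) (huv : ∀ i, v i = 0 → u i = 0) :
    (fun i => u i * (x i / v i)) ∈ relSpace K s := fun j => by
  -- For `h` the unit vector `j`, this writes `(x i / v i) * s i j` on the support of `v` as a
  -- combination of the `s i k` with coefficients `h' k` independent of `i`; the relation `u` kills
  -- such combinations.
  obtain ⟨h', hh'⟩ := mem_cartanOf_iff.1 hx (Pi.single j 1)
  simp only [Pi.single_apply, mul_ite, mul_one, mul_zero, Finset.sum_ite_eq', Finset.mem_univ,
    if_true] at hh'
  have h1 : ∀ i, u i * (x i / v i) * (s i j : K) = ∑ k, h' k * (u i * (s i k : K)) := fun i => by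
    by_cases hi : v i = 0
    · simp [huv i hi]
    · have h2 : x i / v i * (s i j : K) = ∑ k, (s i k : K) * h' k := by
        rw [div_mul_eq_mul_div, mul_comm (x i), ← hh' i, mul_div_cancel_right₀ _ hi]
      rw [mul_assoc, h2, Finset.mul_sum]
      exact Finset.sum_congr rfl fun k _ => by ring
  simp only [h1]
  rw [Finset.sum_comm]
  refine Finset.sum_eq_zero fun k _ => ?_
  rw [← Finset.mul_sum, show ∑ i, u i * (s i k : K) = 0 from hu k, mul_zero]

/-- A coordinate of the support of `v` on which all relations supported on `v` vanish spans a line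
in `cartanOf v`. -/
theorem single_mem_cartanOf {i : Fin n} (hi : v i ≠ 0)
    (hrel : ∀ u ∈ relSpace K s, (∀ k, v k = 0 → u k = 0) → u i = 0) :
    Pi.single i 1 ∈ cartanOf (torusLie K s) v := by
  classical
  let g : Fin n → Fin r → K := fun k => if v k ≠ 0 ∧ k ≠ i then fun j => (s k j : K) else 0
  -- By `hrel`, the weight `s i` is independent of the other weights in the support of `v`. So some
  -- linear form `f` kills those and not `s i`, and a multiple of `f` provides `h'`.
  have hnot : (fun j => (s i j : K)) ∉ Submodule.span K (Set.range g) := by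
    intro hmem
    obtain ⟨c, hc⟩ := (Submodule.mem_span_range_iff_exists_fun K).1 hmem
    have := hrel (fun k => (if v k ≠ 0 ∧ k ≠ i then c k else 0) - if k = i then 1 else 0)
      (fun j => by
        have h1 := congrFun hc j
        rw [Finset.sum_apply] at h1
        simp only [sub_mul, Finset.sum_sub_distrib, ite_mul, one_mul, zero_mul,
          Finset.sum_ite_eq', Finset.mem_univ, if_true]
        rw [← h1, sub_eq_zero]
        refine Finset.sum_congr rfl fun k _ => ?_
        by_cases hk : v k ≠ 0 ∧ k ≠ i
        · simp [g, hk]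
        · rw [if_neg hk]
          simp [g, if_neg hk])
      (fun k hk => by
        have : k ≠ i := by rintro rfl; exact hi hk
        simp [hk, this])
    simp at this
  obtain ⟨f, hf, hker⟩ := Submodule.exists_le_ker_of_notMem hnot
  have hfs : ∀ k, f (fun j => (s k j : K)) = ∑ j, (s k j : K) * f (Pi.single j 1) := fun k => by
    rw [linear_eq_sum]
    simp
  rw [mem_cartanOf_iff]
  intro h
  refine ⟨fun j => (∑ j, (s i j : K) * h j) / v i / f (fun j => (s i j : K)) *
    f (Pi.single j 1), fun k => ?_⟩
  have h1 : ∑ j, (s k j : K) * ((∑ j, (s i j : K) * h j) / v i / f (fun j => (s i j : K)) *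
      f (Pi.single j 1)) =
      (∑ j, (s i j : K) * h j) / v i / f (fun j => (s i j : K)) * f (fun j => (s k j : K)) := by
    rw [hfs k, Finset.mul_sum]
    exact Finset.sum_congr rfl fun j _ => by ring
  rw [h1]
  by_cases hk : k = i
  · subst hk
    rw [Pi.single_eq_same]
    field_simp
  · rw [Pi.single_eq_of_ne hk, mul_zero]
    by_cases hvk : v k = 0
    · rw [hvk, mul_zero]
    · have : f (fun j => (s k j : K)) = 0 := by
        have : g k ∈ LinearMap.ker f := hker (Submodule.subset_span ⟨k, rfl⟩)
        simpa [g, hk, hvk] using this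
      rw [this, mul_zero, zero_mul]

/-- A relation supported on `v` whose support is as large as possible. -/
structure IsGenericRel (s : Fin n → Fin r → ℤ) (v ω : Fin n → K) : Prop where
  mem : ω ∈ relSpace K s
  supp : ∀ i, v i = 0 → ω i = 0
  generic : ∀ u ∈ relSpace K s, (∀ i, v i = 0 → u i = 0) → ∀ i, ω i = 0 → u i = 0

variable {ω : Fin n → K}

/-- The map from `cartanOf v` to relations that sends `x` to `ω x / v`. -/
def cartanToRel (s : Fin n → Fin r → ℤ) (v ω : Fin n → K) :
    cartanOf (torusLie K s) v →ₗ[K] (Fin n → K) where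
  toFun x i := ω i * (x.1 i / v i)
  map_add' x y := funext fun i => by
    change ω i * ((x.1 i + y.1 i) / v i) = ω i * (x.1 i / v i) + ω i * (y.1 i / v i)
    ring
  map_smul' k x := funext fun i => by
    change ω i * ((k * x.1 i) / v i) = k * (ω i * (x.1 i / v i))
    ring

theorem cartanToRel_apply (x : cartanOf (torusLie K s) v) (i : Fin n) :
    cartanToRel s v ω x i = ω i * (x.1 i / v i) := rfl

theorem range_cartanToRel_le (hω : IsGenericRel s v ω) :
    LinearMap.range (cartanToRel s v ω) ≤ relSpace K s := by
  rintro _ ⟨x, rfl⟩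
  exact mul_div_mem_relSpace x.2 hω.mem hω.supp

variable [CharZero K]

theorem coord_eq_zero_of_mem_cartanOf (hv : ∀ i, s i = 0 → v i ≠ 0) {x : Fin n → K}
    (hx : x ∈ cartanOf (torusLie K s) v) {i : Fin n} (hi : v i = 0) : x i = 0 := by
  obtain ⟨j, hj⟩ := Function.ne_iff.1 fun h => hv i h hi
  obtain ⟨h', hh'⟩ := mem_cartanOf_iff.1 hx (Pi.single j 1)
  have := hh' i
  rw [hi, mul_zero] at this
  simp only [Pi.single_apply, mul_ite, mul_one, mul_zero, Finset.sum_ite_eq', Finset.mem_univ,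
    if_true] at this
  exact (mul_eq_zero.1 this.symm).resolve_left (by exact_mod_cast hj)

/-- Over an infinite field, finitely many linear forms that are not identically zero on a space are
simultaneously nonzero at some vector. -/
theorem exists_isGenericRel (s : Fin n → Fin r → ℤ) (v : Fin n → K) :
    ∃ ω, IsGenericRel s v ω := by
  classical
  have : Infinite K := CharZero.infinite K
  obtain ⟨ω, hω, hne⟩ := Module.Dual.exists_forall_mem_ne_zero_of_forall_exists
    (relSpaceOn K s fun i => v i ≠ 0)
    (fun i : {i // ∃ u ∈ relSpaceOn K s fun i => v i ≠ 0, u i ≠ 0} =>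
      (LinearMap.proj i.1 : (Fin n → K) →ₗ[K] K)) fun i => i.2
  refine ⟨ω, hω.1, fun i hi => hω.2 i (by simpa using hi), fun u hu huv i hi => ?_⟩
  by_contra hui
  exact hne ⟨i, u, ⟨hu, fun k hk => huv k (by simpa using hk)⟩, hui⟩ hi

/-- If `cartanOf v` is a Cartan subspace that maps onto the space of relations, then the
representation is visible. -/
theorem positivelyDependent_of_surjective [IsAlgClosed K]
    (hd : (Module.finrank K (cartanOf (torusLie K s) v) : Cardinal) =
      Algebra.trdeg K (invariantFun (torusRep K s)))
    (hsurj : relSpace K s ≤ LinearMap.range (cartanToRel s v ω)) : PositivelyDependent s := by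
  classical
  obtain ⟨a, ha, ha0, hle⟩ := trdeg_invariantFun_le (K := K) s
  -- Surjectivity bounds the dimension of all relations by `dim c = dim V // T`, hence by that of
  -- the relations supported on `a`. So every relation is supported on `a`.
  have hle : Module.finrank K (relSpace K s) ≤
      Module.finrank K (relSpaceOn K s fun i => a i ≠ 0) := by
    refine ((Submodule.finrank_mono hsurj).trans (LinearMap.finrank_range_le _)).trans ?_
    rw [← hd] at hle
    exact_mod_cast hle
  have hall : relSpaceOn K s (fun i => a i ≠ 0) = relSpace K s :=
    Submodule.eq_of_le_of_finrank_le inf_le_left hle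
  have hsuppa : ∀ u ∈ relSpace K s, ∀ i, a i = 0 → u i = 0 := fun u hu i hi => by
    rw [← hall] at hu
    exact hu.2 i (by simpa using hi)
  have hsuppv : ∀ u ∈ relSpace K s, ∀ i, v i = 0 → u i = 0 := fun u hu i hi => by
    obtain ⟨x, hx⟩ := hsurj hu
    have := congrFun hx i
    rw [cartanToRel_apply, hi, div_zero, mul_zero] at this
    exact this.symm
  obtain ⟨x₀, hx₀⟩ := hsurj (intCast_mem_relSpace ha)
  have hx₀ : ∀ i, ω i * (x₀.1 i / v i) = a i := fun i => congrFun hx₀ i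
  intro c hc hc0
  obtain ⟨x₁, hx₁⟩ := hsurj (intCast_mem_relSpace hc)
  have hx₁ : ∀ i, ω i * (x₁.1 i / v i) = c i := fun i => congrFun hx₁ i
  have hac : ∀ i, a i = 0 → c i = 0 := fun i hi => by
    simpa using hsuppa _ (intCast_mem_relSpace hc) i hi
  -- Multiplication by `x₀ / v`, which is nonzero on the support of `a`. Being injective on a
  -- finite-dimensional space it is invertible, so one can divide `c` by `x₀ / v` within the
  -- relations.
  let A : relSpace K s →ₗ[K] relSpace K s :=
    { toFun := fun u => ⟨fun i => u.1 i * (x₀.1 i / v i),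
        mul_div_mem_relSpace x₀.2 u.2 (hsuppv _ u.2)⟩
      map_add' := fun u u' => Subtype.ext (funext fun i => add_mul _ _ _)
      map_smul' := fun k u => Subtype.ext (funext fun i => mul_assoc _ _ _) }
  have hA : Function.Injective A := by
    rw [injective_iff_map_eq_zero]
    intro u hu
    refine Subtype.ext (funext fun i => ?_)
    by_cases hai : a i = 0
    · exact hsuppa _ u.2 i hai
    · have h1 : u.1 i * (x₀.1 i / v i) = 0 := congrFun (congrArg Subtype.val hu) i
      refine (mul_eq_zero.1 h1).resolve_right fun h0 => hai ?_
      have := hx₀ i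
      rw [h0, mul_zero] at this
      exact_mod_cast this.symm
  obtain ⟨c₂, hc₂⟩ := LinearMap.injective_iff_surjective.1 hA ⟨_, intCast_mem_relSpace hc⟩
  have hc₂ : ∀ i, c₂.1 i * (x₀.1 i / v i) = c i := fun i => congrFun (congrArg Subtype.val hc₂) i
  have hsq := mul_div_mem_relSpace x₁.2 c₂.2 (hsuppv _ c₂.2)
  -- As `a = ω x₀ / v` and `c = ω x₁ / v`, the relation `c₂ x₁ / v` equals `c x₁ / x₀ = c² / a`.
  -- Where `a` vanishes, both sides are `0` by the convention for division.
  have hval : ∀ i, c₂.1 i * (x₁.1 i / v i) = (c i : K) ^ 2 / a i := fun i => by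
    by_cases hai : a i = 0
    · rw [hsuppa _ c₂.2 i hai, hai]
      simp
    · have hai' : (a i : K) ≠ 0 := by exact_mod_cast hai
      rw [eq_div_iff hai', ← hx₀ i, sq]
      nth_rewrite 1 [← hc₂ i]
      rw [← hx₁ i]
      ring
  obtain ⟨N, g, hN, hg⟩ := exists_int_multiple fun i => (c i : ℚ) ^ 2 / a i
  have hN' : (0 : ℚ) < N := by exact_mod_cast hN
  have haQ : ∀ i, (0 : ℚ) ≤ a i := fun i => by exact_mod_cast ha0 i
  refine ⟨g, ?_, ?_, fun i => ?_, fun i hi => ?_⟩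
  · rw [← intCast_mem_relSpace_iff (K := K)]
    convert (relSpace K s).smul_mem (N : K) hsq using 1
    funext i
    rw [Pi.smul_apply, hval, smul_eq_mul]
    have := congrArg (Rat.cast : ℚ → K) (hg i)
    push_cast at this
    exact this
  · obtain ⟨k, hk⟩ := Function.ne_iff.1 hc0
    have hk : c k ≠ 0 := hk
    intro hg0
    have h1 := hg k
    rw [hg0] at h1
    have h2 : (c k : ℚ) ≠ 0 := by exact_mod_cast hk
    have h3 : (a k : ℚ) ≠ 0 := by exact_mod_cast mt (hac k) hk
    have : (N : ℚ) * ((c k : ℚ) ^ 2 / a k) ≠ 0 :=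
      mul_ne_zero hN'.ne' (div_ne_zero (pow_ne_zero _ h2) h3)
    exact this (by rw [← h1]; simp)
  · have : (0 : ℚ) ≤ g i := by
      rw [hg]
      exact mul_nonneg hN'.le (div_nonneg (sq_nonneg _) (haQ i))
    exact_mod_cast this
  · have : (g i : ℚ) = 0 := by rw [hg, hi]; simp
    exact_mod_cast this

theorem finrank_range_cartanToRel_lt [IsAlgClosed K] (hω : IsGenericRel s v ω)
    (hd : (Module.finrank K (cartanOf (torusLie K s) v) : Cardinal) =
      Algebra.trdeg K (invariantFun (torusRep K s)))
    (hs : ¬ PositivelyDependent s) :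
    Module.finrank K (LinearMap.range (cartanToRel s v ω)) < Module.finrank K (relSpace K s) := by
  refine lt_of_le_of_ne (Submodule.finrank_mono (range_cartanToRel_le hω)) fun h => hs ?_
  exact positivelyDependent_of_surjective hd
    (Submodule.eq_of_le_of_finrank_eq (range_cartanToRel_le hω) h).ge

theorem finrank_cartanOf_le [IsAlgClosed K]
    (hd : (Module.finrank K (cartanOf (torusLie K s) v) : Cardinal) =
      Algebra.trdeg K (invariantFun (torusRep K s))) :
    Module.finrank K (cartanOf (torusLie K s) v) ≤ Module.finrank K (relSpace K s) := by
  obtain ⟨a, -, -, hle⟩ := trdeg_invariantFun_le (K := K) s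
  rw [← hd] at hle
  refine le_trans (by exact_mod_cast hle) (Submodule.finrank_mono inf_le_left)

end Cartan

/-! ### Orbits that are not met by a Cartan subspace -/

section Closure

universe u

variable {K : Type u} [Field K] {r n : ℕ} {s : Fin n → Fin r → ℤ} {v : Fin n → K}

theorem IsRel.prod_zpow_of_mem_closure {c : Fin n → ℤ} (hc : IsRel s c)
    {z z' : (Fin n → K) × Module.Dual K (Fin n → K)}
    (hz : z' ∈ zariskiClosure K (repOrbit (doubleRep (torusRep K s)) z))
    (h' : ∀ i, c i ≠ 0 → z'.1 i ≠ 0) (h : ∀ i, c i ≠ 0 → z.1 i ≠ 0) :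
    ∏ i, z'.1 i ^ c i = ∏ i, z.1 i ^ c i := by
  have hrel : IsRel (Sum.elim s (-s)) (Sum.elim c 0) := isRel_sumElim_iff.2 (by simpa using hc)
  have := (isDiagonal_doubleRep s).binomial_of_mem_closure hz hrel
  rw [← prod_zpow_eq_iff] at this
  · simpa [Fintype.prod_sum_type] using this
  · rintro (i | i) hi
    · exact h i hi
    · simp at hi
  · rintro (i | i) hi
    · exact h' i hi
    · simp at hi

theorem coord_fst_of_mem_closure {z z' : (Fin n → K) × Module.Dual K (Fin n → K)}
    (hz : z' ∈ zariskiClosure K (repOrbit (doubleRep (torusRep K s)) z)) {i : Fin n}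
    (hi : z.1 i = 0) : z'.1 i = 0 :=
  (isDiagonal_doubleRep s).coord_of_mem_closure hz (i := Sum.inl i) hi

variable [CharZero K]

variable (K s) in
/-- The space of relations has a basis of integral relations. -/
theorem exists_int_basis : ∃ c : Fin (Module.finrank K (relSpace K s)) → Fin n → ℤ,
    (∀ k, IsRel s (c k)) ∧ LinearIndependent K fun k i => (c k i : K) := by
  -- The space is generalised to a variable `M`, so that its equality with a span can be substituted
  -- in the index type `Fin (Module.finrank K M)`.
  suffices key : ∀ Z : Set (Fin n → K), (∀ u ∈ Z, ∃ c : Fin n → ℤ, IsRel s c ∧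
      u = fun i => (c i : K)) → ∀ M, Submodule.span K Z = M →
      ∃ c : Fin (Module.finrank K M) → Fin n → ℤ,
        (∀ k, IsRel s (c k)) ∧ LinearIndependent K fun k i => (c k i : K) by
    refine key {v | ∃ c : Fin n → ℤ, IsRel s c ∧ v = fun i => (c i : K)} (fun _ h => h) _ ?_
    refine le_antisymm (Submodule.span_le.2 ?_) fun u hu => ?_
    · rintro _ ⟨c, hc, rfl⟩
      exact intCast_mem_relSpace hc
    · refine Submodule.span_mono ?_ (mem_span_intCast hu)
      rintro _ ⟨c, hc, -, rfl⟩
      exact ⟨c, hc, rfl⟩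
  rintro Z hZ _ rfl
  obtain ⟨f, hf, -, hind⟩ := Submodule.exists_fun_fin_finrank_span_eq K Z
  choose c hc hfc using fun k => hZ _ (hf k)
  refine ⟨c, hc, ?_⟩
  rwa [← funext hfc]

variable [IsAlgClosed K]

/-- Independent integral relations take arbitrary values as multiplicative characters. -/
theorem exists_prod_zpow_eq {m : ℕ} {c : Fin m → Fin n → ℤ}
    (hc : LinearIndependent K fun k i => (c k i : K)) (τ : Fin m → Kˣ) :
    ∃ t : Fin n → Kˣ, ∀ k, ∏ i, t i ^ c k i = τ k := by
  -- The vectors `c k` now play the role of weights of the torus of rank `n`. Independence leaves no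
  -- relation among them, hence no condition on `τ`.
  obtain ⟨t, ht⟩ := exists_torusChar_eq c τ (fun _ => True) (by
    intro d hd _
    have h0 : ∀ k, (d k : K) = 0 := Fintype.linearIndependent_iff.1 hc _ (by
      funext i
      rw [Finset.sum_apply]
      have := congrArg (Int.cast : ℤ → K) (hd i)
      push_cast at this
      simpa using this)
    have : d = 0 := funext fun k => by exact_mod_cast h0 k
    simp [this])
  exact ⟨t, fun k => ht k trivial⟩

/-- If the representation is not visible, some closed orbit in the null fibre is not in the closure
of the orbit of any point over the Cartan subspace. -/
theorem exists_closed_orbit_not_mem_closure (hv : ∀ i, s i = 0 → v i ≠ 0)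
    (hd : (Module.finrank K (cartanOf (torusLie K s) v) : Cardinal) =
      Algebra.trdeg K (invariantFun (torusRep K s)))
    (hs : ¬ PositivelyDependent s) (Y : Set (Module.Dual K (Fin n → K))) :
    ∃ z ∈ nullFibre (torusLie K s), IsSemisimpleElt (doubleRep (torusRep K s)) z ∧
      ∀ x ∈ cartanOf (torusLie K s) v, ∀ y ∈ Y,
        z ∉ zariskiClosure K (repOrbit (doubleRep (torusRep K s)) (x, y)) := by
  classical
  have : Infinite K := CharZero.infinite K
  by_cases hsupp : ∃ u ∈ relSpace K s, ∃ i, u i ≠ 0 ∧ v i = 0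
  · obtain ⟨u, hu, i, hui, hvi⟩ := hsupp
    have hp : ∀ k, (if u k = 0 then 0 else (1 : K)) ≠ 0 ↔ u k ≠ 0 := fun k => by simp
    refine ⟨relPoint u fun k => if u k = 0 then 0 else 1, relPoint_mem_nullFibre hu hp,
      isSemisimpleElt_relPoint hp, fun x hx y _ hmem => ?_⟩
    have := coord_fst_of_mem_closure hmem (i := i) (coord_eq_zero_of_mem_cartanOf hv hx hvi)
    exact (hp i).2 hui this
  · push Not at hsupp
    obtain ⟨ω, hω⟩ := exists_isGenericRel s v
    have hgen : ∀ u ∈ relSpace K s, ∀ i, ω i = 0 → u i = 0 := fun u hu =>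
      hω.generic u hu fun i hvi => by
        by_contra hui
        exact hsupp u hu i hui hvi
    by_contra! hcon
    set m := Module.finrank K (relSpace K s) with hm
    obtain ⟨c, hc, hind⟩ : ∃ c : Fin m → Fin n → ℤ,
        (∀ k, IsRel s (c k)) ∧ LinearIndependent K fun k i => (c k i : K) := exists_int_basis K s
    have hcω : ∀ k i, c k i ≠ 0 → ω i ≠ 0 := fun k i hki hi => hki (by
      simpa using hgen _ (intCast_mem_relSpace (hc k)) i hi)
    let R := LinearMap.range (cartanToRel s v ω)
    -- On the support of `ω`, this recovers `x i` from `ω x / v`, so the relevant monomials in `x`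
    -- depend only on a point of `R`.
    let X : Fin n → polyFun K (K × R) := fun i =>
      ⟨fun q => v i / ω i * q.2.1 i, linear_mem_polyFun
        ((v i / ω i) • (LinearMap.proj i ∘ₗ R.subtype ∘ₗ
          LinearMap.snd K K R))⟩
    let τ : polyFun K (K × R) := ⟨fun q => q.1, linear_mem_polyFun (LinearMap.fst K K R)⟩
    -- Multiplying all Laurent monomials by the monomial with exponents `N` makes them polynomial.
    -- The extra parameter `τ` and the extra component `none` make up for this factor: the ratios of
    -- components are the original monomials.
    let N : Fin n → ℕ := fun i => ∑ k, (c k i).natAbs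
    have hN : ∀ k i, 0 ≤ (N i : ℤ) + c k i := fun k i => by
      have h1 : (c k i).natAbs ≤ N i :=
        Finset.single_le_sum (f := fun k => (c k i).natAbs) (fun _ _ => Nat.zero_le _)
          (Finset.mem_univ k)
      omega
    let f : Option (Fin m) → polyFun K (K × R) := fun o =>
      o.elim (τ * ∏ i, X i ^ N i) fun k => τ * ∏ i, X i ^ (N i + c k i).toNat
    have hcard := card_le_of_dominant f (P := ∏ o, MvPolynomial.X o)
      (Finset.prod_ne_zero_iff.2 fun o _ => MvPolynomial.X_ne_zero o) (by
        intro b hb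
        rw [map_prod, Finset.prod_ne_zero_iff] at hb
        simp only [MvPolynomial.eval_X, Finset.mem_univ, true_implies] at hb
        obtain ⟨t, ht⟩ := exists_prod_zpow_eq hind fun k =>
          Units.mk0 (b (some k)) (hb _) / Units.mk0 (b none) (hb _)
        let p : Fin n → K := fun i => if ω i = 0 then 0 else t i
        have hp : ∀ i, p i ≠ 0 ↔ ω i ≠ 0 := fun i => by simp [p]
        obtain ⟨x, hx, y, hy, hmem⟩ := hcon (relPoint ω p) (relPoint_mem_nullFibre hω.mem hp)
          (isSemisimpleElt_relPoint hp)
        have hxω : ∀ i, ω i ≠ 0 → x i ≠ 0 := fun i hi hxi =>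
          (hp i).2 hi (coord_fst_of_mem_closure hmem hxi)
        have hprod : ∀ k, ∏ i, x i ^ c k i = b (some k) / b none := fun k => by
          have h1 := (hc k).prod_zpow_of_mem_closure hmem
            (fun i hi => (hp i).2 (hcω k i hi)) fun i hi => hxω i (hcω k i hi)
          have h2 : ∏ i, p i ^ c k i = b (some k) / b none := by
            have h3 := congrArg Units.val (ht k)
            push_cast at h3
            rw [Units.val_mk0, Units.val_mk0] at h3
            rw [← h3]
            refine Finset.prod_congr rfl fun i _ => ?_
            by_cases hi : c k i = 0
            · simp [hi]
            · simp [p, hcω k i hi]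
          exact h1.symm.trans h2
        have hX : ∀ q, ∀ i, ω i ≠ 0 →
            (X i).1 (q, ⟨cartanToRel s v ω ⟨x, hx⟩, ⟨_, rfl⟩⟩) = x i := fun q i hi => by
          change v i / ω i * (ω i * (x i / v i)) = x i
          have hvi : v i ≠ 0 := fun h => hi (hω.supp i h)
          field_simp
        have hN0 : ∀ i, ω i = 0 → N i = 0 := fun i hi =>
          Finset.sum_eq_zero fun k _ => by
            rw [Int.natAbs_eq_zero]
            by_contra h
            exact hcω k i h hi
        have hc0 : ∀ k i, ω i = 0 → c k i = 0 := fun k i hi => by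
          by_contra h
          exact hcω k i h hi
        have hD : ∏ i, x i ^ N i ≠ 0 := prod_pow_ne_zero fun i hi =>
          hxω i fun h => hi (hN0 i h)
        refine ⟨(b none / ∏ i, x i ^ N i, ⟨cartanToRel s v ω ⟨x, hx⟩, ⟨_, rfl⟩⟩), ?_⟩
        rintro (_ | k)
        · change (τ * ∏ i, X i ^ N i).1 _ = _
          rw [← evalAt_apply, map_mul, map_prod]
          simp only [map_pow, evalAt_apply]
          have : ∀ i, (X i).1 (b none / ∏ i, x i ^ N i,
              ⟨cartanToRel s v ω ⟨x, hx⟩, ⟨_, rfl⟩⟩) ^ N i = x i ^ N i := fun i => by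
            by_cases hi : ω i = 0
            · rw [hN0 i hi, pow_zero, pow_zero]
            · rw [hX _ i hi]
          simp only [this]
          exact div_mul_cancel₀ _ hD
        · change (τ * ∏ i, X i ^ (N i + c k i).toNat).1 _ = _
          rw [← evalAt_apply, map_mul, map_prod]
          simp only [map_pow, evalAt_apply]
          have : ∀ i, (X i).1 (b none / ∏ i, x i ^ N i,
              ⟨cartanToRel s v ω ⟨x, hx⟩, ⟨_, rfl⟩⟩) ^ (N i + c k i).toNat =
                x i ^ N i * x i ^ c k i := fun i => by
            by_cases hi : ω i = 0
            · simp [hN0 i hi, hc0 k i hi]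
            · rw [hX _ i hi, ← zpow_natCast, Int.toNat_of_nonneg (hN k i),
                zpow_add₀ (hxω i hi), zpow_natCast]
          simp only [this]
          rw [Finset.prod_mul_distrib, hprod k]
          change b none / _ * _ = _
          have hb0 := hb none
          field_simp)
    -- A dominant map from `K × R` to an affine space of dimension `m + 1` is impossible, since `dim
    -- R < m`.
    have hlt := finrank_range_cartanToRel_lt hω hd hs
    rw [Fintype.card_option, Fintype.card_fin, Module.finrank_prod, Module.finrank_self] at hcard
    have : Module.finrank K R < m := hlt
    omega

end Closure

/-! ### Transcendence degrees of the two quotients -/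

section Rings

universe u

variable {K : Type u} [Field K] {r n : ℕ} {s : Fin n → Fin r → ℤ} {v ω : Fin n → K}

/-- Evaluation of a function on the symplectic reduction at a point of the null fibre. -/
def evalReduction {z : (Fin n → K) × Module.Dual K (Fin n → K)}
    (hz : z ∈ nullFibre (torusLie K s)) :
    symplecticReductionRing (torusRep K s) (torusLie K s) →ₐ[K] K :=
  (Ideal.Quotient.liftₐ (momentIdeal (torusLie K s)) (evalAt z) (by
    intro f hf
    have hle : momentIdeal (torusLie K s) ≤ RingHom.ker (evalAt z) := by
      refine Ideal.span_le.2 ?_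
      rintro f ⟨h, hf⟩
      change f.1 z = 0
      rw [hf, show momentMap (torusLie K s) z = 0 from hz]
      rfl
    exact hle hf)).comp (Subalgebra.val _)

/-- The function on the symplectic reduction defined by an invariant function. -/
def reductionOf (f : polyFun K ((Fin n → K) × Module.Dual K (Fin n → K)))
    (hf : ∀ t, polyFunComap (doubleRep (torusRep K s) t) f = f) :
    symplecticReductionRing (torusRep K s) (torusLie K s) :=
  ⟨Ideal.Quotient.mkₐ K _ f, f, fun t => by rw [hf, sub_self]; exact zero_mem _, rfl⟩

/-- A vector supported on the coordinates of `v` without relations lies in `cartanOf v`. -/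
theorem IsGenericRel.mem_cartanOf (hω : IsGenericRel s v ω) {x : Fin n → K}
    (hxv : ∀ i, v i = 0 → x i = 0) (hxω : ∀ i, ω i ≠ 0 → x i = 0) :
    x ∈ cartanOf (torusLie K s) v := by
  classical
  rw [pi_eq_sum_univ' x]
  refine Submodule.sum_mem _ fun i _ => ?_
  by_cases hi : v i ≠ 0 ∧ ω i = 0
  · refine Submodule.smul_mem _ _ ?_
    convert single_mem_cartanOf hi.1 fun u hu huv => hω.generic u hu huv i hi.2
  · have : x i = 0 := by
      by_cases hvi : v i = 0
      · exact hxv i hvi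
      · exact hxω i fun h => hi ⟨hvi, h⟩
    rw [this, zero_smul]
    exact zero_mem _

variable [CharZero K]

/-- A torus element that acts trivially on the support of `ω` preserves `cartanOf v`. -/
theorem IsGenericRel.torusRep_mem_cartanOf (hv : ∀ i, s i = 0 → v i ≠ 0)
    (hω : IsGenericRel s v ω) {t : Fin r → Kˣ} (ht : ∀ i, ω i ≠ 0 → torusChar t (s i) = 1)
    {x : Fin n → K} (hx : x ∈ cartanOf (torusLie K s) v) :
    torusRep K s t x ∈ cartanOf (torusLie K s) v := by
  have h1 : torusRep K s t x - x ∈ cartanOf (torusLie K s) v := by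
    refine hω.mem_cartanOf (fun i hi => ?_) fun i hi => ?_
    · rw [Pi.sub_apply, torusRep_apply, coord_eq_zero_of_mem_cartanOf hv hx hi]
      simp
    · rw [Pi.sub_apply, torusRep_apply, ht i hi]
      simp
  simpa using add_mem h1 hx

variable [IsAlgClosed K]

/-- The symplectic reduction has transcendence degree at least twice the dimension of the space of
relations. -/
theorem two_mul_finrank_le_trdeg {A : Type u} [CommRing A] [Algebra K A]
    (E : symplecticReductionRing (torusRep K s) (torusLie K s) ≃ₐ[K] A) :
    ((2 * Module.finrank K (relSpace K s) : ℕ) : Cardinal) ≤ Algebra.trdeg K A := by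
  classical
  have : Infinite K := CharZero.infinite K
  obtain ⟨ω, hω⟩ := exists_isGenericRel s fun _ => (1 : K)
  have hgen : ∀ u ∈ relSpace K s, ∀ i, ω i = 0 → u i = 0 := fun u hu =>
    hω.generic u hu fun i hi => (one_ne_zero hi).elim
  set m := Module.finrank K (relSpace K s)
  obtain ⟨c, hc, hind⟩ : ∃ c : Fin m → Fin n → ℤ,
      (∀ k, IsRel s (c k)) ∧ LinearIndependent K fun k i => (c k i : K) := exists_int_basis K s
  have hcω : ∀ k i, ω i = 0 → c k i = 0 := fun k i hi => by
    simpa using hgen _ (intCast_mem_relSpace (hc k)) i hi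
  let b : Module.Basis (Fin m) K (relSpace K s) := Module.finBasis K (relSpace K s)
  have hext : ∀ k, ∃ L : (Fin n → K) →ₗ[K] K, ∀ u : relSpace K s, L u.1 = b.coord k u := fun k => by
    obtain ⟨L, hL⟩ := LinearMap.exists_extend (b.coord k)
    exact ⟨L, fun u => LinearMap.congr_fun hL u⟩
  choose L hL using hext
  let e := prodCoord K n
  -- The first `m` functions are the coordinates of the relation `(x_i y_i)`. The others are the
  -- invariant monomials of the `c k`, with negative exponents of `x` replaced by positive exponents
  -- of `y`.
  let F : Fin m ⊕ Fin m → polyFun K ((Fin n → K) × Module.Dual K (Fin n → K)) := Sum.elim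
    (fun k => ∑ i, algebraMap K _ (L k (Pi.single i 1)) *
      (coordFun e (Sum.inl i) * coordFun e (Sum.inr i)))
    (fun k => monomialFun e (Sum.elim (fun i => (c k i).toNat) fun i => (-c k i).toNat))
  have hFl : ∀ k z, (F (Sum.inl k)).1 z = L k fun i => z.1 i * dualCoord K n z.2 i := fun k z => by
    rw [linear_eq_sum (L k), ← evalAt_apply]
    simp only [F, Sum.elim_inl, map_sum, map_mul, AlgHom.commutes]
    exact Finset.sum_congr rfl fun i _ => mul_comm _ _
  have hFr : ∀ k z, (F (Sum.inr k)).1 z = (∏ i, z.1 i ^ (c k i).toNat) *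
      ∏ i, dualCoord K n z.2 i ^ (-c k i).toNat := fun k z => by
    simp only [F, Sum.elim_inr]
    rw [monomialFun_apply]
    simp [Fintype.prod_sum_type, e]
  have hcoord : ∀ t (z : (Fin n → K) × Module.Dual K (Fin n → K)),
      (∀ i, (doubleRep (torusRep K s) t z).1 i = (torusChar t (s i) : K) * z.1 i) ∧
      ∀ i, dualCoord K n (doubleRep (torusRep K s) t z).2 i =
        (torusChar t (s i) : K)⁻¹ * dualCoord K n z.2 i := fun t z => by
    refine ⟨fun i => isDiagonal_doubleRep s t z (Sum.inl i), fun i => ?_⟩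
    have := isDiagonal_doubleRep s t z (Sum.inr i)
    simpa [torusChar_neg] using this
  have hinv : ∀ o t, polyFunComap (doubleRep (torusRep K s) t) (F o) = F o := by
    intro o t
    refine Subtype.ext (funext fun z => ?_)
    change (F o).1 (doubleRep (torusRep K s) t z) = (F o).1 z
    obtain ⟨h1, h2⟩ := hcoord t z
    rcases o with k | k
    · rw [hFl, hFl]
      congr 1
      funext i
      rw [h1, h2, mul_mul_mul_comm, mul_inv_cancel₀ (Units.ne_zero _), one_mul]
    · rw [hFr, hFr]
      simp only [h1, h2, mul_pow, Finset.prod_mul_distrib]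
      have h3 := congrArg Units.val ((hc k).prod_torusChar t)
      have h4 := prod_zpow_mul_prod_pow (c := c k) (z := fun i => (torusChar t (s i) : K))
        fun i _ => Units.ne_zero _
      push_cast at h3
      rw [h3, one_mul] at h4
      rw [← h4]
      have h5 : (∏ i, (torusChar t (s i) : K) ^ (-c k i).toNat) *
          ∏ i, (torusChar t (s i) : K)⁻¹ ^ (-c k i).toNat = 1 := by
        rw [← Finset.prod_mul_distrib]
        refine Finset.prod_eq_one fun i _ => ?_
        rw [← mul_pow, mul_inv_cancel₀ (Units.ne_zero _), one_pow]
      linear_combination ((∏ i, z.1 i ^ (c k i).toNat) *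
        ∏ i, dualCoord K n z.2 i ^ (-c k i).toNat) * h5
  let lin : Fin n → MvPolynomial (Fin m ⊕ Fin m) K := fun i =>
    ∑ k, MvPolynomial.C ((b k).1 i) * MvPolynomial.X (Sum.inl k)
  have hlin : ∀ i (a : Fin m ⊕ Fin m → K), MvPolynomial.eval a (lin i) =
      (∑ k, a (Sum.inl k) • b k : relSpace K s).1 i := fun i a => by
    simp [lin, mul_comm, Finset.sum_apply]
  -- Nonvanishing of `P` says that the first `m` values define a relation with the full support of
  -- `ω` and that the last `m` values are units. All such values are attained.
  let P : MvPolynomial (Fin m ⊕ Fin m) K :=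
    (∏ i ∈ Finset.univ.filter fun i => ω i ≠ 0, lin i) * ∏ k, MvPolynomial.X (Sum.inr k)
  have hP : P ≠ 0 := by
    refine mul_ne_zero (Finset.prod_ne_zero_iff.2 fun i hi h0 => ?_)
      (Finset.prod_ne_zero_iff.2 fun k _ => MvPolynomial.X_ne_zero _)
    have h1 := hlin i (Sum.elim (fun k => b.repr ⟨ω, hω.mem⟩ k) 0)
    simp only [Sum.elim_inl] at h1
    rw [b.sum_repr, h0, map_zero] at h1
    simp only [Finset.mem_filter, Finset.mem_univ, true_and] at hi
    exact hi h1.symm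
  have halg : AlgebraicIndependent K fun o => E (reductionOf (s := s) (F o) (hinv o)) := by
    refine algebraicIndependent_of_eval _ hP fun a ha => ?_
    simp only [P, map_mul, map_prod, MvPolynomial.eval_X, hlin] at ha
    obtain ⟨ha1, ha2⟩ := mul_ne_zero_iff.1 ha
    simp only [Finset.prod_ne_zero_iff, Finset.mem_filter, Finset.mem_univ, true_and,
      true_implies] at ha1 ha2
    set u : relSpace K s := ∑ k, a (Sum.inl k) • b k
    have hu : ∀ i, u.1 i ≠ 0 ↔ ω i ≠ 0 :=
      fun i => ⟨fun h hi => h (hgen _ u.2 i hi), fun h => ha1 i h⟩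
    have hu0 : ∀ k, ∏ i, u.1 i ^ (-c k i).toNat ≠ 0 := fun k => prod_pow_ne_zero fun i hi =>
      (hu i).2 fun h => hi (by rw [hcω k i h]; rfl)
    obtain ⟨t, ht⟩ := exists_prod_zpow_eq hind fun k =>
      Units.mk0 (a (Sum.inr k)) (ha2 k) / Units.mk0 _ (hu0 k)
    let p : Fin n → K := fun i => if ω i = 0 then 0 else t i
    have hp : ∀ i, p i ≠ 0 ↔ u.1 i ≠ 0 := fun i => by rw [hu]; simp [p]
    refine ⟨(evalReduction (relPoint_mem_nullFibre u.2 hp)).comp E.symm.toAlgHom, fun o => ?_⟩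
    suffices h : (F o).1 (relPoint u.1 p) = a o by
      refine (congrArg (evalReduction (relPoint_mem_nullFibre u.2 hp))
        (E.symm_apply_apply _)).trans h
    rcases o with k | k
    · rw [hFl]
      have h1 : (fun i => (relPoint u.1 p).1 i * dualCoord K n (relPoint u.1 p).2 i) = u.1 := by
        funext i
        by_cases hi : p i = 0
        · have : u.1 i = 0 := not_not.1 (mt (hp i).2 (not_not.2 hi))
          simp [relPoint, hi, this]
        · simp [relPoint, mul_div_cancel₀ _ hi]
      rw [h1, hL]
      simp [u, Finsupp.single_apply]
    · rw [hFr]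
      -- With `y = u / p`, the monomial of `c k` equals `p ^ c k` times `u` to the negative part of
      -- `c k`; `t` was chosen to compensate for the second factor.
      have h2 : ∏ i, p i ^ c k i = a (Sum.inr k) / ∏ i, u.1 i ^ (-c k i).toNat := by
        have h3 := congrArg Units.val (ht k)
        push_cast at h3
        rw [Units.val_mk0, Units.val_mk0] at h3
        rw [← h3]
        refine Finset.prod_congr rfl fun i _ => ?_
        by_cases hi : ω i = 0
        · simp [hcω k i hi]
        · simp [p, hi]
      have h4 := prod_zpow_mul_prod_pow (c := c k) (z := p) fun i hi =>
        (hp i).2 ((hu i).2 fun h => hi (hcω k i h))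
      change (∏ i, p i ^ (c k i).toNat) * ∏ i, dualCoord K n ((dualCoord K n).symm
        fun i => u.1 i / p i) i ^ (-c k i).toNat = _
      rw [LinearEquiv.apply_symm_apply, ← h4, h2]
      simp only [div_pow, Finset.prod_div_distrib]
      have h5 : ∏ i, p i ^ (-c k i).toNat ≠ 0 := prod_pow_ne_zero fun i hi =>
        (hp i).2 ((hu i).2 fun h => hi (by rw [hcω k i h]; rfl))
      have h6 := hu0 k
      field_simp
  have := halg.lift_cardinalMk_le_trdeg
  rw [Cardinal.mk_fintype, Cardinal.lift_natCast, Fintype.card_sum, Fintype.card_fin,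
    Cardinal.lift_id', ← two_mul] at this
  exact this

/-- The transcendence degree of the invariants of the Weyl group, bounded by restriction to the
slice where the coordinates without relations are equal to `1`. -/
theorem trdeg_weylInvariantRing_le (hv : ∀ i, s i = 0 → v i ≠ 0) (hω : IsGenericRel s v ω) :
    Algebra.trdeg K (weylInvariantRing (torusRep K s) (cartanOf (torusLie K s) v)) ≤
      ((Module.finrank K (LinearMap.range (cartanToRel s v ω)) +
        Module.finrank K (cartanOf (torusLie K s) v) : ℕ) : Cardinal) := by
  classical
  have : Infinite K := CharZero.infinite K
  set c := cartanOf (torusLie K s) v with hcdef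
  let c₁ : Submodule K (Fin n → K) := c ⊓
    { carrier := {x | ∀ i, ω i = 0 → x i = 0}
      zero_mem' := fun _ _ => rfl
      add_mem' := fun ha hb i hi => by simp [ha i hi, hb i hi]
      smul_mem' := fun k a ha i hi => by simp [ha i hi] }
  let incl : c₁ →ₗ[K] c := Submodule.inclusion inf_le_left
  have hvanish : ∀ x ∈ c, ∀ i, v i = 0 → x i = 0 := fun x hx i hi =>
    coord_eq_zero_of_mem_cartanOf hv hx hi
  have hc₁ : Module.finrank K c₁ ≤ Module.finrank K (LinearMap.range (cartanToRel s v ω)) := by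
    refine LinearMap.finrank_le_finrank_of_injective
      (f := (cartanToRel s v ω).rangeRestrict ∘ₗ incl) ?_
    rw [injective_iff_map_eq_zero]
    intro x hx
    refine Subtype.ext (funext fun i => ?_)
    by_cases hi : ω i = 0
    · exact x.2.2 i hi
    · have hvi : v i ≠ 0 := fun h => hi (hω.supp i h)
      have h1 : ω i * (x.1 i / v i) = 0 :=
        congrFun (congrArg Subtype.val hx) i
      have h2 := (mul_eq_zero.1 h1).resolve_left hi
      exact (div_eq_zero_iff.1 h2).resolve_right hvi
  let x₀ : c := ⟨fun i => if v i ≠ 0 ∧ ω i = 0 then 1 else 0, hω.mem_cartanOf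
    (fun i hi => by simp [hi]) fun i hi => by simp [hi]⟩
  have hx₀ : ∀ i, x₀.1 i = if v i ≠ 0 ∧ ω i = 0 then 1 else 0 := fun i => rfl
  refine (trdeg_le_of_slice _ (isPolyMap_affine (W₀ := c₁ × Module.Dual K c)
    ((x₀, 0) : c × Module.Dual K c)
    (incl.prodMap (LinearMap.id : Module.Dual K c →ₗ[K] Module.Dual K c))) ?_).trans ?_
  · intro f hf hfU
    have step1 : ∀ (x : c) ψ, (∀ i, v i ≠ 0 → ω i = 0 → x.1 i ≠ 0) → f.1 (x, ψ) = 0 := by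
      intro x ψ hx
      -- Relations supported on `v` do not involve coordinates where `ω` vanishes. The torus can
      -- therefore rescale these freely to `1` while fixing the support of `ω`; such elements
      -- preserve `c` and so belong to its Weyl group.
      obtain ⟨t, ht⟩ := exists_torusChar_eq s
        (fun i => if h : ω i = 0 ∧ x.1 i ≠ 0 then (Units.mk0 (x.1 i) h.2)⁻¹ else 1)
        (fun i => v i ≠ 0) (by
          intro d hd hdv
          refine Finset.prod_eq_one fun i _ => ?_
          by_cases hi : ω i = 0
          · have : d i = 0 := by
              simpa using hω.generic _ (intCast_mem_relSpace hd)
                (fun k hk => by simp [hdv k (by simpa using hk)]) i hi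
            rw [this, zpow_zero]
          · rw [dif_neg (fun h => hi h.1), one_zpow])
      have ht1 : ∀ i, ω i ≠ 0 → torusChar t (s i) = 1 := fun i hi => by
        rw [ht i fun h => hi (hω.supp i h), dif_neg fun h => hi h.1]
      have ht1' : ∀ i, ω i ≠ 0 → torusChar t⁻¹ (s i) = 1 := fun i hi => by
        rw [torusChar_inv, ht1 i hi, inv_one]
      let w : c ≃ₗ[K] c := LinearEquiv.ofLinearMap
        ((torusRep K s t).restrict fun x hx => hω.torusRep_mem_cartanOf hv ht1 hx)
        ((torusRep K s t⁻¹).restrict fun x hx => hω.torusRep_mem_cartanOf hv ht1' hx)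
        (LinearMap.ext fun x => Subtype.ext (by
          change torusRep K s t (torusRep K s t⁻¹ x.1) = x.1
          simp))
        (LinearMap.ext fun x => Subtype.ext (by
          change torusRep K s t⁻¹ (torusRep K s t x.1) = x.1
          simp))
      have hw : w ∈ weylGroup (torusRep K s) c := ⟨t, fun _ => rfl⟩
      have hmem : (w x - x₀).1 ∈ c₁ := by
        refine ⟨(w x - x₀).2, fun i hi => ?_⟩
        change torusRep K s t x.1 i - x₀.1 i = 0
        rw [torusRep_apply, hx₀]
        by_cases hvi : v i = 0
        · simp [hvi, hvanish x.1 x.2 i hvi]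
        · have hxi := hx i hvi hi
          rw [ht i hvi, dif_pos ⟨hi, hxi⟩, if_pos ⟨hvi, hi⟩]
          simp [hxi]
      have h1 : f.1 (doubleAut w (x, ψ)) = f.1 (x, ψ) :=
        congrFun (congrArg Subtype.val (hf w hw)) (x, ψ)
      have h2 := hfU (⟨_, hmem⟩, ψ ∘ₗ w.symm.toLinearMap)
      rw [← h1, ← h2]
      refine congrArg f.1 (Prod.ext ?_ ?_)
      · change w x = x₀ + (w x - x₀)
        simp
      · change ψ ∘ₗ w.symm.toLinearMap = 0 + ψ ∘ₗ w.symm.toLinearMap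
        simp
    refine Subtype.ext (funext fun ⟨x, ψ⟩ => ?_)
    refine eq_zero_of_line f.2 (x, ψ) (x₀, 0)
      ((Finset.univ.image fun i => -x.1 i).finite_toSet.subset ?_)
    intro τ hτ
    by_contra hcon
    have hsum : ((x, ψ) : c × Module.Dual K c) + τ • (x₀, 0) = (x + τ • x₀, ψ) := by simp
    rw [Set.mem_ofPred_eq, hsum] at hτ
    refine hτ (step1 _ _ fun i hvi hωi h0 => hcon ?_)
    have h0 : x.1 i + τ * x₀.1 i = 0 := h0
    rw [hx₀, if_pos ⟨hvi, hωi⟩, mul_one] at h0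
    simp only [Finset.coe_image, Finset.coe_univ, Set.image_univ, Set.mem_range]
    exact ⟨i, by linear_combination -h0⟩
  · rw [Module.finrank_prod, Subspace.dual_finrank_eq]
    exact_mod_cast Nat.add_le_add_right hc₁ _

/-- An isomorphism would force `2 m ≤ rank + dim c`, with `rank` the dimension of the image of
`cartanToRel` and `m` that of the relations. But `rank < m` without visibility, and `dim c ≤ m`. -/
theorem isEmpty_symplecticReductionRing_equiv (hv : ∀ i, s i = 0 → v i ≠ 0)
    (hd : (Module.finrank K (cartanOf (torusLie K s) v) : Cardinal) =
      Algebra.trdeg K (invariantFun (torusRep K s)))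
    (hs : ¬ PositivelyDependent s) :
    IsEmpty (symplecticReductionRing (torusRep K s) (torusLie K s) ≃ₐ[K]
      weylInvariantRing (torusRep K s) (cartanOf (torusLie K s) v)) := by
  refine ⟨fun E => ?_⟩
  obtain ⟨ω, hω⟩ := exists_isGenericRel s v
  have h1 := two_mul_finrank_le_trdeg
    (A := weylInvariantRing (torusRep K s) (cartanOf (torusLie K s) v)) E
  have h2 := h1.trans (trdeg_weylInvariantRing_le hv hω)
  have h3 := finrank_range_cartanToRel_lt hω hd hs
  have h4 := finrank_cartanOf_le hd
  have h5 := Nat.cast_le.1 h2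
  omega

end Rings

end MomentTorus

end

theorem mainTheorem5 {K : Type*} [Field K] [IsAlgClosed K] [CharZero K] {r n : ℕ}
    (s : Fin n → Fin r → ℤ) :
    (MomentTorus.IsVisible (MomentTorus.torusRep K s) ↔
      {O : Set ((Fin n → K) × Module.Dual K (Fin n → K)) |
          ∃ z ∈ MomentTorus.nullFibre (MomentTorus.torusLie K s),
            O = MomentTorus.repOrbit (MomentTorus.doubleRep (MomentTorus.torusRep K s)) z ∧
            MomentTorus.IsZariskiClosed K O} =
        {O : Set ((Fin n → K) × Module.Dual K (Fin n → K)) |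
          ∃ x y, (x, y) ∈ MomentTorus.nullFibre (MomentTorus.torusLie K s) ∧
            O = MomentTorus.repOrbit (MomentTorus.doubleRep (MomentTorus.torusRep K s)) (x, y) ∧
            MomentTorus.IsSemisimpleElt (MomentTorus.torusRep K s) x ∧
            MomentTorus.IsSemisimpleElt (MomentTorus.torusRep K s).dual y}) ∧
    (¬ MomentTorus.IsVisible (MomentTorus.torusRep K s) →
      ∀ c : Submodule K (Fin n → K),
        MomentTorus.IsCartanSubspace (MomentTorus.torusRep K s) (MomentTorus.torusLie K s) c →
        (∀ c' : Submodule K (Module.Dual K (Fin n → K)),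
          ∃ z ∈ MomentTorus.nullFibre (MomentTorus.torusLie K s),
            MomentTorus.IsSemisimpleElt
              (MomentTorus.doubleRep (MomentTorus.torusRep K s)) z ∧
            ∀ x ∈ c, ∀ y ∈ c',
              z ∉ MomentTorus.zariskiClosure K (MomentTorus.repOrbit
                (MomentTorus.doubleRep (MomentTorus.torusRep K s)) (x, y))) ∧
        IsEmpty
          (MomentTorus.symplecticReductionRing (MomentTorus.torusRep K s)
              (MomentTorus.torusLie K s) ≃ₐ[K]
            MomentTorus.weylInvariantRing (MomentTorus.torusRep K s) c)) := by
  classical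
  refine ⟨MomentTorus.isVisible_iff_closed_orbits s, fun hvis c hc => ?_⟩
  rw [MomentTorus.isVisible_torusRep_iff] at hvis
  obtain ⟨v, rfl, hd⟩ := hc
  -- Making `v` nonzero at the coordinates of weight `0` does not change the Cartan subspace, and
  -- guarantees that its elements vanish wherever `v` does.
  rw [MomentTorus.cartanOf_eq_of_weight_zero v] at hd ⊢
  have hv : ∀ i, s i = 0 → (if s i = 0 then 1 else v i) ≠ 0 := fun i hi => by simp [hi]
  exact ⟨fun c' => MomentTorus.exists_closed_orbit_not_mem_closure hv hd hvis c',
    MomentTorus.isEmpty_symplecticReductionRing_equiv hv hd hvis⟩
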